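/- **Notation.** For $n\ge 1$, positive $A_k,B_k$ with $\sum_k A_k=\sum_k B_k$ and $a_k,b_k\in\mathbb{R}$ $(1\le k\le n)$, put $\delta=\prod_k A_k^{-A_k}\prod_k B_k^{B_k}$. Fox's $H$-function is, for $0<z<\delta$, $$H^{n,0}_{n,n}\left[z\,\middle|\,\begin{matrix}(a_k,A_k)_{1,n}\\(b_k,B_k)_{1,n}\end{matrix}\right]=\frac1{2\pi i}\int_{L}\frac{\prod_{k=1}^n\Gamma(B_ks+b_k)}{\prod_{k=1}^n\Gamma(A_ks+a_k)}\,z^{-s}\,ds ,$$ where $L$ is a left loop, lying in a horizontal strip, which starts at $-\infty+i\varphi_1$, ends at $-\infty+i\varphi_2$ $(\varphi_1<\varphi_2)$ and surrounds all the poles of the functions $\Gamma(B_ks+b_k)$ (the choice of $L$ is immaterial; we take $L$ to consist of two horizontal half-lines and a vertical segment). For $z\geq\delta$ we set, as usual, $H^{n,0}_{n,n}[z]=0$. For a bounded tempered distribution $f$ on $\mathbb{R}$ (i.e. $f*\varphi\in L^\infty$ for all Schwartz functions $\varphi$) let $M_Pf(x)=\sup_{t>0}|(P_t*f)(x)|$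 with $P_t(x)=t^{-1}P(x/t)$, $P(x)=\frac1{\pi(1+x^2)}$. The Hardy space $H^1(\mathbb{R})$ consists of the bounded tempered distributions $f$ with $M_Pf\in L^1(\mathbb{R})$, and $\|f\|_{H^1}=\|M_Pf\|_{L^1}$. **Theorem.** Let $n\ge 1$ and let $\varepsilon_k,\xi_k>0$, $\alpha_k\ge 0$, $\tau_k\in\mathbb{R}$ $(k=1,\dots,n)$ satisfy 1. $\sum_{k=1}^n \frac1{\xi_k}=\sum_{k=1}^n\frac1{\varepsilon_k}$; 2. $\sum_{k=1}^n\alpha_k>0$; 3. $\min_{1\le k\le n}\tau_k\xi_k>-1$. Then $$\mathsf{k}_2:=\int_1^\infty\left|H^{n,0}_{n,n}\left[\frac1\sigma\,\middle|\,\begin{matrix}(\tau_k+\alpha_k+1/\varepsilon_k,\,1/\varepsilon_k)_{1,n}\\(\tau_k+1/\xi_k,\,1/\xi_k)_{1,n}\end{matrix}\right]\right|\frac{d\sigma}{\sigma}<\infty .$$ Moreover every $f\in H^1(\mathbb{R})$ is (given by) a function in $L^1(\mathbb{R})$, the integral $$Kf(x)=K^{(\tau_k),(\alpha_k)}_{(\varepsilon_k),(\xi_k),n}f(x)=\int_1^\infty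 H^{n,0}_{n,n}\left[\frac1u\,\middle|\,\begin{matrix}(\tau_k+\alpha_k+1/\varepsilon_k,\,1/\varepsilon_k)_{1,n}\\(\tau_k+1/\xi_k,\,1/\xi_k)_{1,n}\end{matrix}\right]f(xu)\,du$$ converges absolutely for almost every $x\in\mathbb{R}$, the function $Kf$ belongs to $L^1(\mathbb{R})$ and to $H^1(\mathbb{R})$, and $$\|Kf\|_{H^1}\le\mathsf{k}_2\,\|f\|_{H^1}.$$ -/

import Mathlib

open MeasureTheory Set SchwartzMap
open scoped ENNReal BoundedContinuousFunction

noncomputable section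

/-! ### The Hardy space `H¹(ℝ)` -/

/-- The reflection `φ̃(x) = φ(-x)` of a Schwartz function. -/
def schwartzReflect : 𝓢(ℝ, ℂ) →L[ℂ] 𝓢(ℝ, ℂ) :=
  SchwartzMap.compCLMOfContinuousLinearEquiv ℂ (ContinuousLinearEquiv.neg ℝ)

/-- The convolution `(f * φ)(x) = ⟨f, φ(x - ·)⟩` of a tempered distribution with a Schwartz
function. -/
def distribConv (f : 𝓢'(ℝ, ℂ)) (φ : 𝓢(ℝ, ℂ)) (x : ℝ) : ℂ :=
  f ((schwartzReflect φ).compSubConstCLM ℂ x)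

/-- A tempered distribution `f` is bounded if `f * φ ∈ L^∞` for every Schwartz function `φ`. -/
def IsBoundedDistribution (f : 𝓢'(ℝ, ℂ)) : Prop :=
  ∀ φ : 𝓢(ℝ, ℂ), MemLp (distribConv f φ) ∞ volume

/-- The dilated Poisson kernel `P_t(x) = t⁻¹ P(x / t)`, where `P(x) = 1 / (π (1 + |x|²))`. -/
def poissonKernelLine (t x : ℝ) : ℝ :=
  t⁻¹ * (1 / Real.pi * (1 / (1 + |x / t| ^ 2)))

/-- The bounded continuous function `u` is `P_t * f`. As for every bounded distribution `f` and
every integrable function `h`, the convolution `h * f` is the distribution given by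
`⟨h * f, φ⟩ = ⟨f * φ̃, h̃⟩ = ∫ (f * φ̃)(y) h(-y) dy`. At most one `u` has this property. -/
def IsPoissonConv (t : ℝ) (f : 𝓢'(ℝ, ℂ)) (u : ℝ →ᵇ ℂ) : Prop :=
  ∀ φ : 𝓢(ℝ, ℂ), ∫ x, u x * φ x =
    ∫ y, distribConv f (schwartzReflect φ) y * (poissonKernelLine t (-y) : ℂ)

open Classical in
/-- `P_t * f`, as a bounded continuous function. -/
def poissonConv (t : ℝ) (f : 𝓢'(ℝ, ℂ)) : ℝ →ᵇ ℂ :=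
  if h : ∃ u, IsPoissonConv t f u then h.choose else 0

/-- The Poisson maximal function `M_P f(x) = sup_{t > 0} |(P_t * f)(x)|`, with values in
`[0, ∞]`. -/
def poissonMaximal (f : 𝓢'(ℝ, ℂ)) (x : ℝ) : ℝ≥0∞ :=
  ⨆ t ∈ Ioi (0 : ℝ), ‖poissonConv t f x‖ₑ

/-- `f ∈ H¹(ℝ)`: the tempered distribution `f` is bounded and `M_P f ∈ L¹(ℝ)`. For a bounded
distribution `f`, the distribution `P_t * f` is always a bounded continuous function; the field
`exists_poissonConv` records that `poissonConv t f` really is this function. (`M_P f` is lower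
semicontinuous, so it is in `L¹` as soon as its integral is finite.) -/
structure MemH1 (f : 𝓢'(ℝ, ℂ)) : Prop where
  bounded : IsBoundedDistribution f
  exists_poissonConv : ∀ t : ℝ, 0 < t → ∃ u, IsPoissonConv t f u
  lintegral_lt_top : ∫⁻ x, poissonMaximal f x < ∞

/-- The norm `‖f‖_{H¹} = ‖M_P f‖_{L¹}`. -/
def h1Norm (f : 𝓢'(ℝ, ℂ)) : ℝ :=
  (∫⁻ x, poissonMaximal f x).toReal

/-! ### Fox's `H`-function `H^{n,0}_{n,n}` in the case `∑ A_k = ∑ B_k` -/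

/-- A left loop `L_{-∞}` for `H^{n,0}_{n,n}`: it comes from `-∞ + i lower` along a horizontal line
to `corner + i lower`, goes up to `corner + i upper`, and returns along a horizontal line to
`-∞ + i upper`. It has all the poles `-(b_k + j) / B_k` (`j = 0, 1, 2, …`) of the functions
`Γ(B_k s + b_k)` on its left, that is, inside. -/
structure LeftLoop {n : ℕ} (b : Fin n → ℂ) (B : Fin n → ℝ) where
  corner : ℝ
  lower : ℝ
  upper : ℝ
  lower_lt_upper : lower < upper
  re_pole_lt : ∀ (k : Fin n) (j : ℕ), (-(b k + j) / (B k : ℂ)).re < corner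
  lower_lt_im_pole : ∀ (k : Fin n) (j : ℕ), lower < (-(b k + j) / (B k : ℂ)).im
  im_pole_lt_upper : ∀ (k : Fin n) (j : ℕ), (-(b k + j) / (B k : ℂ)).im < upper

/-- The contour integral `∫_L F(s) ds` over a left loop `L`. -/
def LeftLoop.integral {n : ℕ} {b : Fin n → ℂ} {B : Fin n → ℝ} (L : LeftLoop b B)
    (F : ℂ → ℂ) : ℂ :=
  (∫ x in Iic L.corner, F (x + L.lower * Complex.I))
    + (∫ y in L.lower..L.upper, F (L.corner + y * Complex.I) * Complex.I)
    - ∫ x in Iic L.corner, F (x + L.upper * Complex.I)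

/-- The integrand `∏ Γ(B_k s + b_k) / ∏ Γ(A_k s + a_k) · z^{-s}` of `H^{n,0}_{n,n}`. (Where
`Γ(A_k s + a_k)` has a pole, `Complex.Gamma` is `0`, so that its inverse is `0`, as it should
be.) -/
def foxIntegrand {n : ℕ} (a : Fin n → ℂ) (A : Fin n → ℝ) (b : Fin n → ℂ) (B : Fin n → ℝ)
    (z : ℝ) (s : ℂ) : ℂ :=
  (∏ k, Complex.Gamma (B k * s + b k)) / (∏ k, Complex.Gamma (A k * s + a k)) * (z : ℂ) ^ (-s)

/-- `δ = ∏ A_k^{-A_k} ∏ B_k^{B_k}`. -/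
def foxRadius {n : ℕ} (A B : Fin n → ℝ) : ℝ :=
  (∏ k, A k ^ (-A k)) * ∏ k, B k ^ B k

/-- Fox's `H`-function `H^{n,0}_{n,n}[z | (a_k, A_k); (b_k, B_k)]` for real `z > 0`, in the case
`∑ A_k = ∑ B_k`. For `z < δ` it is `(2πi)⁻¹` times the integral over a left loop. For `z > δ` the
standard definition takes a right loop `L_{+∞}` around the poles of the functions
`Γ(1 - a_i - A_i s)` in the numerator; there are none of these in `H^{n,0}_{n,n}`, and the
value is `0`. -/
def foxH {n : ℕ} (a : Fin n → ℂ) (A : Fin n → ℝ) (b : Fin n → ℂ) (B : Fin n → ℝ)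
    (L : LeftLoop b B) (z : ℝ) : ℂ :=
  if z < foxRadius A B then
    (2 * Real.pi * Complex.I)⁻¹ * L.integral (foxIntegrand a A b B z)
  else 0

/-! ### The operator `K` -/

/-- The left loops for the parameters `b_k = τ_k + 1 / ξ_k`, `B_k = 1 / ξ_k`. -/
abbrev KLoop {n : ℕ} (ξ τ : Fin n → ℝ) : Type :=
  LeftLoop (fun k => ((τ k + 1 / ξ k : ℝ) : ℂ)) (fun k => 1 / ξ k)

/-- The kernel
`u ↦ H^{n,0}_{n,n}[1/u | (τ_k + α_k + 1/ε_k, 1/ε_k); (τ_k + 1/ξ_k, 1/ξ_k)]`. -/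
def kernelK {n : ℕ} (ε ξ τ α : Fin n → ℝ) (L : KLoop ξ τ) (u : ℝ) : ℂ :=
  foxH (fun k => ((τ k + α k + 1 / ε k : ℝ) : ℂ)) (fun k => 1 / ε k)
    (fun k => ((τ k + 1 / ξ k : ℝ) : ℂ)) (fun k => 1 / ξ k) L (1 / u)

/-- The multiple Erdélyi-Kober operator `K^{(τ_k),(α_k)}_{(ε_k),(ξ_k),n}` in the case
`∑ α_k > 0`. -/
def operatorK {n : ℕ} (ε ξ τ α : Fin n → ℝ) (L : KLoop ξ τ) (f : ℝ → ℂ) (x : ℝ) : ℂ :=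
  ∫ u in Ioi (1 : ℝ), kernelK ε ξ τ α L u * f (x * u)

end

/-! Write κ for the kernel. `Kf` is an average, with weight κ(u) du, of the dilates f(xu). A dilate
is harmless for the Poisson maximal function: P_t convolved with f(·u) at x equals (P_{tu} * f)(xu),
and tu runs over all positive scales as t does. Hence M_P(Kf)(x) ≤ ∫ |κ(u)| M_P f(xu) du, and
integrating in x turns each dilation into a factor 1/u, which gives the constant ∫ |κ(u)| du/u
(`memH1_dilationAverage`).

Two facts remain. The first is that this constant is finite (`lintegral_foxH_lt_top`). With μ = ∑
a_k - ∑ b_k = ∑ α_k, Stirling's formula shows that the Gamma quotient is O(δ^{-t} t^{-μ}) at real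
part -t on a horizontal line off the real axis. All poles lie in Re s < 0, so the loop may be taken
there; by Tonelli, the integral of σ^{Re s} dσ/σ over σ > 1/δ is δ^{-Re s}/(-Re s), and what is left
on the half-lines is O(t^{-μ-1}), integrable because μ > 0.

The second is that an element of H¹ is an integrable function (`MemH1.exists_integrable`). Letting t
→ 0 in P_t * f gives |f(φ)| ≤ ∫ |φ| M_P f, and duality in L² of the finite measure M_P f dx provides
the density. -/

/-! ### Stirling's formula for the real Gamma function -/

/-- Stirling's formula for the logarithm of the Gamma function, up to a bounded error, at
natural numbers. -/
theorem exists_abs_log_Gamma_natCast_sub_le :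
    ∃ C : ℝ, ∀ n : ℕ, 1 ≤ n →
      |Real.log (Real.Gamma n) - ((n - 1 / 2) * Real.log n - n)| ≤ C := by
  obtain ⟨a, ha, hle⟩ := Stirling.stirlingSeq'_bounded_by_pos_constant
  refine ⟨max |Real.log a| |Real.log (Stirling.stirlingSeq 1)| + |Real.log 2 / 2|, ?_⟩
  intro n hn
  obtain ⟨m, rfl⟩ : ∃ m, n = m + 1 := ⟨n - 1, by omega⟩
  have hpos := Stirling.stirlingSeq'_pos m
  have h1 : Real.log a ≤ Real.log (Stirling.stirlingSeq (m + 1)) :=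
    Real.log_le_log ha (hle m)
  have h2 : Real.log (Stirling.stirlingSeq (m + 1)) ≤ Real.log (Stirling.stirlingSeq 1) :=
    Real.log_le_log hpos (Stirling.stirlingSeq'_antitone (Nat.zero_le m))
  have hm : (0 : ℝ) < (m + 1 : ℕ) := by positivity
  have h3 := Stirling.log_stirlingSeq_formula (m + 1)
  have h4 : Real.log ((m + 1).factorial : ℝ) =
      Real.log (m + 1 : ℕ) + Real.log (Real.Gamma (m + 1 : ℕ)) := by
    rw [← Real.Gamma_nat_eq_factorial, Real.Gamma_add_one hm.ne',
      Real.log_mul hm.ne' (Real.Gamma_pos_of_pos hm).ne']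
  rw [Real.log_div hm.ne' (Real.exp_pos 1).ne', Real.log_exp, h4,
    Real.log_mul two_ne_zero hm.ne'] at h3
  have h5 : Real.log (Real.Gamma (m + 1 : ℕ)) -
      (((m + 1 : ℕ) - 1 / 2) * Real.log (m + 1 : ℕ) - (m + 1 : ℕ)) =
      Real.log (Stirling.stirlingSeq (m + 1)) + Real.log 2 / 2 := by
    rw [h3]; ring
  rw [h5]
  exact (abs_add_le _ _).trans (by gcongr; exact abs_le_max_abs_abs h1 h2)

/-- Stirling's formula for the logarithm of the Gamma function, up to a bounded error. -/
theorem exists_abs_log_Gamma_sub_le :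
    ∃ C : ℝ, ∀ y : ℝ, 2 ≤ y →
      |Real.log (Real.Gamma y) - ((y - 1 / 2) * Real.log y - y)| ≤ C := by
  obtain ⟨C, hC⟩ := exists_abs_log_Gamma_natCast_sub_le
  -- Of the 3, the replacement of s log (n - 1) by s log n costs 1, and the increment (n + s -
  -- 1/2)(log (n + s) - log n) costs 2.
  refine ⟨C + 3, fun y hy => ?_⟩
  set n := ⌊y⌋₊ with hn
  have hn2 : 2 ≤ n := Nat.le_floor (by exact_mod_cast hy)
  have hn2' : (2 : ℝ) ≤ n := by exact_mod_cast hn2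
  have hCn := hC n (by omega)
  have hny : (n : ℝ) ≤ y := Nat.floor_le (by linarith)
  have hyn : y < n + 1 := Nat.lt_floor_add_one y
  have hfeq : ∀ {x : ℝ}, 0 < x →
      (Real.log ∘ Real.Gamma) (x + 1) = (Real.log ∘ Real.Gamma) x + Real.log x := by
    intro x hx
    simp only [Function.comp]
    rw [Real.Gamma_add_one hx.ne', Real.log_mul hx.ne' (Real.Gamma_pos_of_pos hx).ne', add_comm]
  rcases hny.eq_or_lt with h0 | h0
  · rw [← h0]; linarith
  clear_value n
  obtain ⟨s, rfl⟩ : ∃ s, y = n + s := ⟨y - n, by ring⟩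
  have hs0 : 0 < s := by linarith
  have hs1 : s < 1 := by linarith
  -- Log-convexity puts log Γ(n + s) between log Γ(n) + s log (n - 1) and log Γ(n) + s log n, which
  -- carries the formula from n to n + s.
  have hup := Real.BohrMollerup.f_add_nat_le Real.convexOn_log_Gamma hfeq (by omega : n ≠ 0)
    hs0 hs1.le
  have hlo := Real.BohrMollerup.f_add_nat_ge Real.convexOn_log_Gamma hfeq hn2 hs0
  simp only [Function.comp] at hup hlo
  have hl1 : 0 ≤ Real.log ((n + s) / n) := Real.log_nonneg (by
    rw [le_div_iff₀ (by linarith)]; linarith)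
  have hl2 : Real.log ((n + s) / n) ≤ s / n := by
    refine (Real.log_le_sub_one_of_pos (by positivity)).trans_eq ?_
    field_simp; ring
  rw [Real.log_div (by positivity) (by positivity)] at hl1 hl2
  set l := Real.log (n + s) - Real.log n with hl
  have hl3 : ((n : ℝ) + s - 1 / 2) * l ≤ 2 := by
    calc ((n : ℝ) + s - 1 / 2) * l ≤ (n + s - 1 / 2) * (s / n) := by gcongr; linarith
      _ ≤ (n + n) * (1 / n) := by gcongr; linarith
      _ = 2 := by field_simp; norm_num
  have hl4 : 0 ≤ ((n : ℝ) + s - 1 / 2) * l := mul_nonneg (by linarith) hl1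
  have hl5 : Real.log n ≤ Real.log (n - 1) + 1 := by
    have : Real.log (n / (n - 1)) ≤ n / (n - 1) - 1 :=
      Real.log_le_sub_one_of_pos (div_pos (by linarith) (by linarith))
    rw [Real.log_div (by linarith) (by linarith)] at this
    have h6 : (n : ℝ) / (n - 1) ≤ 2 := by
      rw [div_le_iff₀ (by linarith)]; linarith
    linarith
  have hl6 : s * Real.log n ≤ s * Real.log (n - 1) + 1 := by
    nlinarith
  rw [abs_le] at hCn ⊢
  have hid : ((n : ℝ) + s - 1 / 2) * Real.log (n + s) =
      (n - 1 / 2) * Real.log n + s * Real.log n + (n + s - 1 / 2) * l := by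
    rw [hl]; ring
  rw [hid]
  constructor <;> linarith [hCn.1, hCn.2]

/-- Stirling's formula for `log Γ(At + c)` as `t → ∞`, up to a bounded error. -/
theorem exists_abs_log_Gamma_mul_add_sub_le {A : ℝ} (hA : 0 < A) (c : ℝ) :
    ∃ C : ℝ, ∀ᶠ t : ℝ in Filter.atTop,
      |Real.log (Real.Gamma (A * t + c)) -
        ((A * t + c - 1 / 2) * Real.log t + A * Real.log A * t - A * t)| ≤ C := by
  obtain ⟨C, hC⟩ := exists_abs_log_Gamma_sub_le
  refine ⟨C + |(c - 1 / 2) * Real.log A| + |c| + 4 * |c| + 2 * |c|, ?_⟩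
  -- The threshold ensures both At + c ≥ 2 and |c/(At)| ≤ 1/2.
  filter_upwards [Filter.eventually_ge_atTop ((2 * |c| + 2) / A)] with t ht
  rw [div_le_iff₀ hA, mul_comm] at ht
  have hc := abs_nonneg c
  have hc' := neg_abs_le c
  have hAt : 0 < A * t := by linarith
  have ht0 : 0 < t := pos_of_mul_pos_right hAt hA.le
  have h1 := hC (A * t + c) (by linarith)
  have hy : 0 < A * t + c := by linarith
  have hx : |c / (A * t)| ≤ 1 / 2 := by
    rw [abs_div, abs_of_pos hAt, div_le_iff₀ hAt]; linarith
  have hlog : |Real.log (A * t + c) - Real.log (A * t)| ≤ 2 * (|c| / (A * t)) := by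
    rw [← Real.log_div hy.ne' hAt.ne']
    have h2 : (A * t + c) / (A * t) = 1 + c / (A * t) := by field_simp
    have h3 : |c / (A * t)| = |c| / (A * t) := by rw [abs_div, abs_of_pos hAt]
    rw [h2, ← h3]
    set x := c / (A * t)
    have hx' := abs_le.1 hx
    have h4 : 0 < 1 + x := by linarith
    rw [abs_le]
    constructor
    · have h5 := Real.one_sub_inv_le_log_of_pos h4
      have h6 : 1 - (1 + x)⁻¹ = x / (1 + x) := by field_simp; ring
      rw [h6] at h5
      refine le_trans ?_ h5
      rw [le_div_iff₀ h4]
      have := neg_abs_le x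
      nlinarith [abs_nonneg x]
    · have h5 := Real.log_le_sub_one_of_pos h4
      linarith [le_abs_self x, abs_nonneg x]
  set l := Real.log (A * t + c) - Real.log (A * t) with hl
  have h7 : |(A * t + c - 1 / 2) * l| ≤ 4 * |c| := by
    rw [abs_mul]
    calc |A * t + c - 1 / 2| * |l| ≤ (2 * (A * t)) * (2 * (|c| / (A * t))) := by
          gcongr
          rw [abs_le]; constructor <;> linarith [le_abs_self c]
      _ = 4 * |c| := by field_simp; ring
  have hid : Real.log (Real.Gamma (A * t + c)) -
        ((A * t + c - 1 / 2) * Real.log t + A * Real.log A * t - A * t) =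
      (Real.log (Real.Gamma (A * t + c)) -
        ((A * t + c - 1 / 2) * Real.log (A * t + c) - (A * t + c))) +
      ((A * t + c - 1 / 2) * l + (c - 1 / 2) * Real.log A - c) := by
    rw [hl, Real.log_mul hA.ne' ht0.ne']; ring
  rw [hid]
  refine (abs_add_le _ _).trans ?_
  have h8 := abs_sub ((A * t + c - 1 / 2) * l + (c - 1 / 2) * Real.log A) c
  have h9 := abs_add_le ((A * t + c - 1 / 2) * l) ((c - 1 / 2) * Real.log A)
  linarith

/-! ### Comparison of the complex and real Gamma functions on horizontal lines -/

theorem norm_Gamma_le_Gamma_re {s : ℂ} (hs : 0 < s.re) : ‖Complex.Gamma s‖ ≤ Real.Gamma s.re := by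
  rw [Complex.Gamma_eq_integral hs, Real.Gamma_eq_integral hs]
  refine (norm_integral_le_integral_norm _).trans_eq ?_
  refine setIntegral_congr_fun measurableSet_Ioi fun x hx => ?_
  simp only [norm_mul]
  rw [Complex.norm_of_nonneg (Real.exp_pos _).le,
    Complex.norm_cpow_eq_rpow_re_of_pos hx, Complex.sub_re, Complex.one_re]

theorem norm_betaIntegral_le {p : ℝ} (hp : 0 < p) (y : ℝ) :
    ‖Complex.betaIntegral p (1 + y * Complex.I)‖ ≤ 1 / p := by
  have h : ∫ x : ℝ in (0 : ℝ)..1, x ^ (p - 1) = 1 / p := by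
    rw [integral_rpow (Or.inl (by linarith))]
    simp [Real.zero_rpow hp.ne']
  rw [Complex.betaIntegral, ← h, intervalIntegral.integral_of_le zero_le_one,
    intervalIntegral.integral_of_le zero_le_one]
  refine (norm_integral_le_integral_norm _).trans ?_
  rw [integral_Ioc_eq_integral_Ioo, integral_Ioc_eq_integral_Ioo]
  refine (setIntegral_congr_fun measurableSet_Ioo fun x hx => ?_).le
  have h1 : (1 : ℂ) - x = ((1 - x : ℝ) : ℂ) := by push_cast; ring
  simp only [norm_mul]
  rw [h1, Complex.norm_cpow_eq_rpow_re_of_pos hx.1,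
    Complex.norm_cpow_eq_rpow_re_of_pos (by linarith [hx.2])]
  simp

/-- With p = Re s - 1 and y = Im s, Γ(p) Γ(1 + iy) = Γ(s) B(p, 1 + iy), where |B| ≤ 1/p and p Γ(p) =
Γ(Re s). For fixed imaginary part, |Γ(s)| is thus comparable with Γ(Re s), so real Stirling
suffices. -/
theorem mul_Gamma_re_le_norm_Gamma {s : ℂ} (hs : 1 < s.re) :
    ‖Complex.Gamma (1 + s.im * Complex.I)‖ * Real.Gamma s.re ≤ ‖Complex.Gamma s‖ := by
  set p := s.re - 1 with hp
  have hp0 : 0 < p := by linarith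
  have hsum : (p : ℂ) + (1 + s.im * Complex.I) = s := by
    apply Complex.ext <;> simp [hp]
  have h := Complex.Gamma_mul_Gamma_eq_betaIntegral (s := p) (t := 1 + s.im * Complex.I)
    (by simpa using hp0) (by simp)
  rw [hsum, Complex.Gamma_ofReal] at h
  have h2 := congrArg norm h
  rw [norm_mul, norm_mul, Complex.norm_of_nonneg (Real.Gamma_pos_of_pos hp0).le] at h2
  have h3 : Real.Gamma s.re = p * Real.Gamma p := by
    rw [← Real.Gamma_add_one hp0.ne', hp]; ring_nf
  have h4 := norm_betaIntegral_le hp0 s.im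
  calc ‖Complex.Gamma (1 + s.im * Complex.I)‖ * Real.Gamma s.re
      = p * (Real.Gamma p * ‖Complex.Gamma (1 + s.im * Complex.I)‖) := by rw [h3]; ring
    _ = p * (‖Complex.Gamma s‖ * ‖Complex.betaIntegral p (1 + s.im * Complex.I)‖) := by rw [h2]
    _ ≤ p * (‖Complex.Gamma s‖ * (1 / p)) := by gcongr
    _ = ‖Complex.Gamma s‖ := by field_simp

theorem norm_sin_le_cosh_im (w : ℂ) : ‖Complex.sin w‖ ≤ Real.cosh w.im := by
  rw [Complex.sin, norm_div, norm_mul, Complex.norm_I, mul_one, Complex.norm_two, Real.cosh_eq]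
  gcongr
  refine (norm_sub_le _ _).trans ?_
  simp [Complex.norm_exp]

theorem abs_sinh_im_le_norm_sin (w : ℂ) : |Real.sinh w.im| ≤ ‖Complex.sin w‖ := by
  rw [Complex.sin, norm_div, norm_mul, Complex.norm_I, mul_one, Complex.norm_two, Real.sinh_eq,
    abs_div, abs_two]
  gcongr
  refine le_trans ?_ (abs_norm_sub_norm_le _ _)
  simp [Complex.norm_exp]

theorem norm_Gamma_mul_norm_Gamma_one_sub (s : ℂ) :
    ‖Complex.Gamma s‖ * ‖Complex.Gamma (1 - s)‖ = Real.pi / ‖Complex.sin (Real.pi * s)‖ := by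
  rw [← norm_mul, Complex.Gamma_mul_Gamma_one_sub, norm_div,
    Complex.norm_of_nonneg Real.pi_pos.le]

/-- Reflection passes to 1 - s, whose real part exceeds 1 so that the lower bound applies; the lower
bound for the sine depends on Im s alone, so the first factor is constant along a horizontal line.
-/
theorem norm_Gamma_le_of_re_neg {s : ℂ} (hs : s.re < 0) (hs' : s.im ≠ 0) :
    ‖Complex.Gamma s‖ ≤
      Real.pi / |Real.sinh (Real.pi * s.im)| / ‖Complex.Gamma (1 - s.im * Complex.I)‖ *
        (Real.Gamma (1 - s.re))⁻¹ := by
  have h1 := mul_Gamma_re_le_norm_Gamma (s := 1 - s)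
    (by rw [Complex.sub_re, Complex.one_re]; linarith)
  simp only [Complex.sub_re, Complex.one_re, Complex.sub_im, Complex.one_im, zero_sub,
    Complex.ofReal_neg, neg_mul, ← sub_eq_add_neg] at h1
  have h0 : 0 < ‖Complex.Gamma (1 - s.im * Complex.I)‖ :=
    norm_pos_iff.2 (Complex.Gamma_ne_zero_of_re_pos (by simp))
  have hG : 0 < Real.Gamma (1 - s.re) := Real.Gamma_pos_of_pos (by linarith)
  have h2 := norm_Gamma_mul_norm_Gamma_one_sub s
  have h3 := abs_sinh_im_le_norm_sin (Real.pi * s)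
  rw [Complex.im_ofReal_mul] at h3
  have h4 : 0 < |Real.sinh (Real.pi * s.im)| :=
    abs_pos.2 (by simpa [Real.sinh_eq_zero, Real.pi_ne_zero] using hs')
  have h5 : ‖Complex.Gamma s‖ * (‖Complex.Gamma (1 - s.im * Complex.I)‖ * Real.Gamma (1 - s.re)) ≤
      Real.pi / |Real.sinh (Real.pi * s.im)| := by
    calc _ ≤ ‖Complex.Gamma s‖ * ‖Complex.Gamma (1 - s)‖ := by gcongr
      _ = _ := h2
      _ ≤ _ := by gcongr
  rw [← div_eq_mul_inv, div_div, le_div_iff₀ (by positivity)]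
  exact h5

/-- The same reflection, now with upper bounds for the sine and for Γ(1 - s). -/
theorem inv_norm_Gamma_le_of_re_lt_one {s : ℂ} (hs : s.re < 1) (hs' : s.im ≠ 0) :
    ‖Complex.Gamma s‖⁻¹ ≤
      Real.cosh (Real.pi * s.im) / Real.pi * Real.Gamma (1 - s.re) := by
  have h2 := norm_Gamma_mul_norm_Gamma_one_sub s
  have h1 := norm_Gamma_le_Gamma_re (s := 1 - s) (by simpa using hs)
  simp only [Complex.sub_re, Complex.one_re] at h1
  have h3 := norm_sin_le_cosh_im (Real.pi * s)
  have h3' := abs_sinh_im_le_norm_sin (Real.pi * s)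
  rw [Complex.im_ofReal_mul] at h3 h3'
  have h4 : 0 < |Real.sinh (Real.pi * s.im)| :=
    abs_pos.2 (by simpa [Real.sinh_eq_zero, Real.pi_ne_zero] using hs')
  have h5 : 0 < ‖Complex.sin (Real.pi * s)‖ := h4.trans_le h3'
  have hpi := Real.pi_pos
  have h6 : ‖Complex.Gamma s‖ ≠ 0 := by
    intro h; rw [h, zero_mul] at h2
    exact (div_pos hpi h5).ne h2
  have h7 : ‖Complex.Gamma s‖⁻¹ = ‖Complex.sin (Real.pi * s)‖ / Real.pi * ‖Complex.Gamma (1 - s)‖ := by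
    rw [eq_div_iff h5.ne'] at h2
    generalize ‖Complex.sin (Real.pi * s)‖ = S at *
    rw [inv_eq_one_div, div_eq_iff h6, ← h2]
    have h8 : ‖Complex.Gamma (1 - s)‖ ≠ 0 := by
      intro h; rw [h, mul_zero, zero_mul] at h2; exact hpi.ne h2
    field_simp
  rw [h7]
  gcongr

/-- The exponent in Stirling's formula for `Γ(Bt + 1 - b)`. -/
noncomputable def stirlingExponent (B b t : ℝ) : ℝ :=
  (B * t + (1 - b) - 1 / 2) * Real.log t + B * Real.log B * t - B * t

theorem exists_norm_Gamma_le_exp_neg {B : ℝ} (hB : 0 < B) (b : ℝ) {y : ℝ} (hy : y ≠ 0) :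
    ∃ C : ℝ, ∀ᶠ t : ℝ in Filter.atTop,
      ‖Complex.Gamma (B * ((-t : ℝ) + y * Complex.I) + b)‖ ≤
        C * Real.exp (-stirlingExponent B b t) := by
  obtain ⟨C, hC⟩ := exists_abs_log_Gamma_mul_add_sub_le hB (1 - b)
  refine ⟨Real.pi / |Real.sinh (Real.pi * (B * y))| /
    ‖Complex.Gamma (1 - (B * y : ℝ) * Complex.I)‖ * Real.exp C, ?_⟩
  filter_upwards [hC, Filter.eventually_gt_atTop (b / B)] with t ht htb
  rw [div_lt_iff₀ hB] at htb
  have hre : (B * ((-t : ℝ) + y * Complex.I) + b : ℂ).re = b - B * t := by simp; ring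
  have him : (B * ((-t : ℝ) + y * Complex.I) + b : ℂ).im = B * y := by simp
  have h := norm_Gamma_le_of_re_neg (s := B * ((-t : ℝ) + y * Complex.I) + b)
    (by rw [hre]; linarith) (by rw [him]; positivity)
  rw [hre, him] at h
  refine h.trans ?_
  rw [mul_assoc, ← Real.exp_add]
  gcongr
  have hG : 0 < Real.Gamma (1 - (b - B * t)) := Real.Gamma_pos_of_pos (by linarith)
  rw [← Real.exp_log hG, ← Real.exp_neg]
  apply Real.exp_le_exp.2
  rw [show 1 - (b - B * t) = B * t + (1 - b) by ring]
  rw [abs_le] at ht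
  rw [stirlingExponent]
  linarith [ht.1]

theorem exists_inv_norm_Gamma_le_exp {A : ℝ} (hA : 0 < A) (a : ℝ) {y : ℝ} (hy : y ≠ 0) :
    ∃ C : ℝ, ∀ᶠ t : ℝ in Filter.atTop,
      ‖Complex.Gamma (A * ((-t : ℝ) + y * Complex.I) + a)‖⁻¹ ≤
        C * Real.exp (stirlingExponent A a t) := by
  obtain ⟨C, hC⟩ := exists_abs_log_Gamma_mul_add_sub_le hA (1 - a)
  refine ⟨Real.cosh (Real.pi * (A * y)) / Real.pi * Real.exp C, ?_⟩
  filter_upwards [hC, Filter.eventually_gt_atTop (a / A)] with t ht hta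
  rw [div_lt_iff₀ hA] at hta
  have hre : (A * ((-t : ℝ) + y * Complex.I) + a : ℂ).re = a - A * t := by simp; ring
  have him : (A * ((-t : ℝ) + y * Complex.I) + a : ℂ).im = A * y := by simp
  have h := inv_norm_Gamma_le_of_re_lt_one (s := A * ((-t : ℝ) + y * Complex.I) + a)
    (by rw [hre]; linarith) (by rw [him]; positivity)
  rw [hre, him] at h
  refine h.trans ?_
  rw [mul_assoc, ← Real.exp_add]
  have hpi := Real.pi_pos
  gcongr
  have hG : 0 < Real.Gamma (1 - (a - A * t)) := Real.Gamma_pos_of_pos (by linarith)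
  rw [← Real.exp_log hG]
  apply Real.exp_le_exp.2
  rw [show 1 - (a - A * t) = A * t + (1 - a) by ring]
  rw [abs_le] at ht
  rw [stirlingExponent]
  linarith [ht.2]

/-! ### Decay of the Gamma quotient on horizontal lines -/

theorem foxRadius_pos {n : ℕ} {A B : Fin n → ℝ} (hA : ∀ k, 0 < A k) (hB : ∀ k, 0 < B k) :
    0 < foxRadius A B :=
  mul_pos (Finset.prod_pos fun k _ => Real.rpow_pos_of_pos (hA k) _)
    (Finset.prod_pos fun k _ => Real.rpow_pos_of_pos (hB k) _)

theorem log_foxRadius {n : ℕ} {A B : Fin n → ℝ} (hA : ∀ k, 0 < A k) (hB : ∀ k, 0 < B k) :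
    Real.log (foxRadius A B) = ∑ k, B k * Real.log (B k) - ∑ k, A k * Real.log (A k) := by
  have h1 : ∀ k, A k ^ (-A k) ≠ 0 := fun k => (Real.rpow_pos_of_pos (hA k) _).ne'
  have h2 : ∀ k, B k ^ B k ≠ 0 := fun k => (Real.rpow_pos_of_pos (hB k) _).ne'
  rw [foxRadius, Real.log_mul (Finset.prod_ne_zero_iff.2 fun k _ => h1 k)
    (Finset.prod_ne_zero_iff.2 fun k _ => h2 k), Real.log_prod fun k _ => h1 k,
    Real.log_prod fun k _ => h2 k]
  simp only [Real.log_rpow (hA _), Real.log_rpow (hB _), neg_mul, Finset.sum_neg_distrib]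
  ring

/-- The quotient of Gamma functions in the integrand of the `H`-function. -/
noncomputable def foxRatio {n : ℕ} (a : Fin n → ℂ) (A : Fin n → ℝ) (b : Fin n → ℂ)
    (B : Fin n → ℝ) (s : ℂ) : ℂ :=
  (∏ k, Complex.Gamma (B k * s + b k)) / ∏ k, Complex.Gamma (A k * s + a k)

/-- On a horizontal line off the real axis, the quotient of Gamma functions in the integrand of
the `H`-function is `O(δ^{-t} t^{-μ})` at `-t → -∞`, where `μ = ∑ a_k - ∑ b_k`. -/
theorem exists_norm_foxRatio_le {n : ℕ} {A B : Fin n → ℝ} (hA : ∀ k, 0 < A k) (hB : ∀ k, 0 < B k)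
    (hAB : ∑ k, A k = ∑ k, B k) (a b : Fin n → ℝ) {y : ℝ} (hy : y ≠ 0) :
    ∃ C : ℝ, ∀ᶠ t : ℝ in Filter.atTop,
      ‖foxRatio (fun k => (a k : ℂ)) A (fun k => (b k : ℂ)) B ((-t : ℝ) + y * Complex.I)‖ ≤
        C * (foxRadius A B ^ (-t) * t ^ (-(∑ k, a k - ∑ k, b k))) := by
  choose CB hCB using fun k => exists_norm_Gamma_le_exp_neg (hB k) (b k) hy
  choose CA hCA using fun k => exists_inv_norm_Gamma_le_exp (hA k) (a k) hy
  refine ⟨(∏ k, CB k) * ∏ k, CA k, ?_⟩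
  filter_upwards [Filter.eventually_all.2 hCB, Filter.eventually_all.2 hCA,
    Filter.eventually_gt_atTop 0] with t h1 h2 ht
  -- In the sum of the Stirling exponents, the terms in t log t and the terms -Bt, At cancel because
  -- ∑ A = ∑ B, and the constants 1 - 1/2 cancel because both products have n factors. The terms B
  -- log B and A log A add up to log δ.
  have h3 : foxRadius A B ^ (-t) * t ^ (-(∑ k, a k - ∑ k, b k)) =
      (∏ k, Real.exp (-stirlingExponent (B k) (b k) t)) *
        ∏ k, Real.exp (stirlingExponent (A k) (a k) t) := by
    rw [← Real.exp_sum, ← Real.exp_sum, ← Real.exp_add,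
      Real.rpow_def_of_pos (foxRadius_pos hA hB), Real.rpow_def_of_pos ht, ← Real.exp_add,
      log_foxRadius hA hB]
    congr 1
    simp only [stirlingExponent, Finset.sum_neg_distrib, Finset.sum_add_distrib,
      Finset.sum_sub_distrib, ← Finset.sum_mul, hAB]
    ring
  rw [foxRatio, norm_div, norm_prod, norm_prod, h3, div_eq_mul_inv, ← Finset.prod_inv_distrib]
  calc _ ≤ (∏ k, CB k * Real.exp (-stirlingExponent (B k) (b k) t)) *
        ∏ k, CA k * Real.exp (stirlingExponent (A k) (a k) t) := by
        refine mul_le_mul (Finset.prod_le_prod (fun k _ => norm_nonneg _) fun k _ => h1 k)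
          (Finset.prod_le_prod (fun k _ => by positivity) fun k _ => h2 k)
          (Finset.prod_nonneg fun k _ => by positivity)
          (Finset.prod_nonneg fun k _ => (norm_nonneg _).trans (h1 k))
    _ = _ := by rw [Finset.prod_mul_distrib, Finset.prod_mul_distrib]; ring

/-! ### Absolute integrability of the H-function against dσ/σ -/

section FoxH

variable {n : ℕ} {A B : Fin n → ℝ} {a b : Fin n → ℝ}

/-- 1/Γ is entire, and with the value 0 at its poles Γ is everywhere the pointwise inverse of 1/Γ.
-/
theorem measurable_Gamma_complex : Measurable Complex.Gamma := by
  have h := Complex.differentiable_one_div_Gamma.continuous.measurable.inv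
  convert! h using 1
  ext s
  simp

@[fun_prop]
theorem measurable_foxRatio (a : Fin n → ℂ) (A : Fin n → ℝ) (b : Fin n → ℂ) (B : Fin n → ℝ) :
    Measurable (foxRatio a A b B) := by
  have := measurable_Gamma_complex
  unfold foxRatio
  fun_prop

theorem foxIntegrand_eq (a : Fin n → ℂ) (A : Fin n → ℝ) (b : Fin n → ℂ) (B : Fin n → ℝ) (z : ℝ)
    (s : ℂ) : foxIntegrand a A b B z s = foxRatio a A b B s * (z : ℂ) ^ (-s) := rfl

/-- Only poles of the numerator matter, since each reciprocal of a Gamma factor is entire. -/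
theorem differentiableAt_foxRatio (a : Fin n → ℂ) (A : Fin n → ℝ) {b : Fin n → ℂ} {B : Fin n → ℝ}
    {s : ℂ} (hs : ∀ (k : Fin n) (m : ℕ), B k * s + b k ≠ -m) :
    DifferentiableAt ℂ (foxRatio a A b B) s := by
  have h1 : DifferentiableAt ℂ (fun s => ∏ k, Complex.Gamma (B k * s + b k)) s := by
    refine DifferentiableAt.fun_finsetProd fun k _ => ?_
    exact (Complex.differentiableAt_Gamma _ (hs k)).comp s (f := fun s => B k * s + b k)
      (by fun_prop)
  have h2 : DifferentiableAt ℂ (fun s => ∏ k, (Complex.Gamma (A k * s + a k))⁻¹) s := by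
    refine DifferentiableAt.fun_finsetProd fun k _ => ?_
    exact (Complex.differentiable_one_div_Gamma _).comp s (f := fun s => A k * s + a k)
      (by fun_prop)
  refine (h1.mul h2).congr_of_eventuallyEq (Filter.Eventually.of_forall fun w => ?_)
  simp [foxRatio, div_eq_mul_inv]

theorem differentiableAt_foxIntegrand (a : Fin n → ℂ) (A : Fin n → ℝ) {b : Fin n → ℂ}
    {B : Fin n → ℝ} {s : ℂ} (hs : ∀ (k : Fin n) (m : ℕ), B k * s + b k ≠ -m) {z : ℝ}
    (hz : 0 < z) : DifferentiableAt ℂ (foxIntegrand a A b B z) s := by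
  have hz' : (z : ℂ) ≠ 0 := by exact_mod_cast hz.ne'
  exact (differentiableAt_foxRatio a A hs).mul
    (differentiableAt_id.neg.const_cpow (Or.inl hz'))

theorem mul_add_ne_neg_natCast_of_im_ne_zero (hB : ∀ k, 0 < B k) {s : ℂ} (hs : s.im ≠ 0)
    (k : Fin n) (m : ℕ) : B k * s + (b k : ℂ) ≠ -m := by
  intro h
  have := congrArg Complex.im h
  simp [(hB k).ne', hs] at this

theorem mul_add_ne_neg_natCast_of_re_pos {s : ℂ} (hs : ∀ k, 0 < B k * s.re + b k)
    (k : Fin n) (m : ℕ) : B k * s + (b k : ℂ) ≠ -m := by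
  intro h
  have := congrArg Complex.re h
  simp only [Complex.add_re, Complex.re_ofReal_mul, Complex.ofReal_re, Complex.neg_re,
    Complex.natCast_re] at this
  have h1 : (0 : ℝ) ≤ m := by positivity
  linarith [hs k]

theorem norm_foxIntegrand (a : Fin n → ℂ) (A : Fin n → ℝ) (b : Fin n → ℂ) (B : Fin n → ℝ) {z : ℝ}
    (hz : 0 < z) (s : ℂ) :
    ‖foxIntegrand a A b B z s‖ = ‖foxRatio a A b B s‖ * z ^ (-s.re) := by
  rw [foxIntegrand_eq, norm_mul, Complex.norm_cpow_eq_rpow_re_of_pos hz, Complex.neg_re]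

theorem continuous_foxRatio_horizontal (hB : ∀ k, 0 < B k) (a : Fin n → ℂ) (A : Fin n → ℝ) {y : ℝ}
    (hy : y ≠ 0) :
    Continuous fun x : ℝ => foxRatio a A (fun k => (b k : ℂ)) B (x + y * Complex.I) := by
  rw [continuous_iff_continuousAt]
  intro x
  exact ContinuousAt.comp (f := fun x : ℝ => (x + y * Complex.I : ℂ))
    (differentiableAt_foxRatio a A
      (mul_add_ne_neg_natCast_of_im_ne_zero hB (by simpa using hy))).continuousAt (by fun_prop)

theorem continuous_foxIntegrand_horizontal (hB : ∀ k, 0 < B k) (a : Fin n → ℂ) (A : Fin n → ℝ)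
    {y : ℝ} (hy : y ≠ 0) {z : ℝ} (hz : 0 < z) :
    Continuous fun x : ℝ => foxIntegrand a A (fun k => (b k : ℂ)) B z (x + y * Complex.I) := by
  rw [continuous_iff_continuousAt]
  intro x
  exact ContinuousAt.comp (f := fun x : ℝ => (x + y * Complex.I : ℂ))
    (differentiableAt_foxIntegrand a A
      (mul_add_ne_neg_natCast_of_im_ne_zero hB (by simpa using hy)) hz).continuousAt (by fun_prop)

/-- The integrand of the `H`-function is integrable on the horizontal half-lines of a loop. -/
theorem integrableOn_foxIntegrand_horizontal (hA : ∀ k, 0 < A k) (hB : ∀ k, 0 < B k)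
    (hAB : ∑ k, A k = ∑ k, B k) (hab : 0 ≤ ∑ k, a k - ∑ k, b k) {y : ℝ} (hy : y ≠ 0)
    {z : ℝ} (hz : 0 < z) (hz' : z < foxRadius A B) (c : ℝ) :
    IntegrableOn (fun x : ℝ => foxIntegrand (fun k => (a k : ℂ)) A (fun k => (b k : ℂ)) B z
      (x + y * Complex.I)) (Iic c) := by
  have hcont := continuous_foxIntegrand_horizontal (b := b) hB (fun k => (a k : ℂ)) A hy hz
  obtain ⟨C, hC⟩ := exists_norm_foxRatio_le hA hB hAB a b hy
  have hδ := foxRadius_pos hA hB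
  -- As z < δ and t^{-μ} ≤ 1 for t ≥ 1, the integrand is O((z/δ)^t) = O(e^{-lt}).
  set l := Real.log (foxRadius A B) - Real.log z
  have hl : 0 < l := sub_pos.2 (Real.log_lt_log hz hz')
  have key : IntegrableOn (fun t : ℝ => foxIntegrand (fun k => (a k : ℂ)) A
      (fun k => (b k : ℂ)) B z (((-t : ℝ) : ℂ) + y * Complex.I)) (Ici (-c)) := by
    refine LocallyIntegrableOn.integrableOn_of_isBigO_atTop
      (g := fun t => Real.exp (-l * t)) ?_ ?_ ?_
    · exact (hcont.comp continuous_neg).locallyIntegrable.locallyIntegrableOn _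
    · refine Asymptotics.IsBigO.of_bound C ?_
      filter_upwards [hC, Filter.eventually_ge_atTop 1] with t ht ht1
      rw [norm_foxIntegrand _ _ _ _ hz, Real.norm_of_nonneg (Real.exp_pos _).le]
      have hC0 : 0 ≤ C := by
        refine nonneg_of_mul_nonneg_left ((norm_nonneg _).trans ht) ?_
        have : 0 < t := by linarith
        positivity
      have h1 : t ^ (-(∑ k, a k - ∑ k, b k)) ≤ 1 :=
        Real.rpow_le_one_of_one_le_of_nonpos ht1 (by linarith)
      have h2 : Real.exp (-l * t) = foxRadius A B ^ (-t) * z ^ t := by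
        rw [Real.rpow_def_of_pos hδ, Real.rpow_def_of_pos hz, ← Real.exp_add]
        congr 1; simp only [l]; ring
      have h3 : -(((-t : ℝ) : ℂ) + y * Complex.I).re = t := by simp
      rw [h2, h3, ← mul_assoc]
      gcongr
      refine ht.trans ?_
      gcongr
      exact mul_le_of_le_one_right (by positivity) h1
    · exact ⟨Ioi 0, Filter.Ioi_mem_atTop 0, integrableOn_exp_mul_Ioi (by linarith) 0⟩
  have := IntegrableOn.comp_neg_Iic key
  simpa using this

/-- The weight is the integral of σ^x dσ/σ over σ > 1/δ. It cancels the exponential factor and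
leaves O(t^{-μ-1}), t = -x; here μ > 0 is needed strictly. -/
theorem integrableOn_norm_foxRatio_horizontal (hA : ∀ k, 0 < A k) (hB : ∀ k, 0 < B k)
    (hAB : ∑ k, A k = ∑ k, B k) (hab : 0 < ∑ k, a k - ∑ k, b k) {y : ℝ} (hy : y ≠ 0)
    {c : ℝ} (hc : c < 0) :
    IntegrableOn (fun x : ℝ => ‖foxRatio (fun k => (a k : ℂ)) A (fun k => (b k : ℂ)) B
      (x + y * Complex.I)‖ * (foxRadius A B ^ (-x) / (-x))) (Iic c) := by
  have hcont := continuous_foxRatio_horizontal (b := b) hB (fun k => (a k : ℂ)) A hy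
  obtain ⟨C, hC⟩ := exists_norm_foxRatio_le hA hB hAB a b hy
  have hδ := foxRadius_pos hA hB
  set μ := ∑ k, a k - ∑ k, b k
  have key : IntegrableOn (fun t : ℝ => ‖foxRatio (fun k => (a k : ℂ)) A (fun k => (b k : ℂ)) B
      (((-t : ℝ) : ℂ) + y * Complex.I)‖ * (foxRadius A B ^ t / t)) (Ici (-c)) := by
    refine LocallyIntegrableOn.integrableOn_of_isBigO_atTop
      (g := fun t => t ^ (-μ - 1)) ?_ ?_ ?_
    · refine ContinuousOn.locallyIntegrableOn ?_ measurableSet_Ici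
      refine (hcont.comp continuous_neg).norm.continuousOn.mul ?_
      refine ContinuousOn.div ?_ continuousOn_id fun t ht => ?_
      · exact (Real.continuous_const_rpow hδ.ne').continuousOn
      · have : -c ≤ t := ht
        exact (by linarith : (0 : ℝ) < t).ne'
    · refine Asymptotics.IsBigO.of_bound C ?_
      filter_upwards [hC, Filter.eventually_gt_atTop 0] with t ht ht1
      rw [norm_mul, norm_norm, Real.norm_of_nonneg (by positivity),
        Real.norm_of_nonneg (by positivity)]
      calc _ ≤ C * (foxRadius A B ^ (-t) * t ^ (-μ)) * (foxRadius A B ^ t / t) := by gcongr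
        _ = C * ((foxRadius A B ^ (-t) * foxRadius A B ^ t) * (t ^ (-μ) / t)) := by ring
        _ = C * t ^ (-μ - 1) := by
          rw [← Real.rpow_add hδ, neg_add_cancel, Real.rpow_zero, one_mul, Real.rpow_sub_one ht1.ne']
    · exact ⟨Ioi 1, Filter.Ioi_mem_atTop 1, integrableOn_Ioi_rpow_of_lt (by linarith) one_pos⟩
  have := IntegrableOn.comp_neg_Iic key
  simpa using this

/-- The corner of a left loop may be moved as long as no pole is crossed. -/
theorem LeftLoop.integral_foxIntegrand_eq (hA : ∀ k, 0 < A k) (hB : ∀ k, 0 < B k)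
    (hAB : ∑ k, A k = ∑ k, B k) (hab : 0 ≤ ∑ k, a k - ∑ k, b k)
    (L : LeftLoop (fun k => (b k : ℂ)) B) (hl : L.lower ≠ 0) (hu : L.upper ≠ 0)
    {z : ℝ} (hz : 0 < z) (hz' : z < foxRadius A B) {c : ℝ} (hc : ∀ k, 0 < B k * c + b k)
    (hcL : c ≤ L.corner) {F : ℂ → ℂ}
    (hF : F = foxIntegrand (fun k => (a k : ℂ)) A (fun k => (b k : ℂ)) B z) :
    L.integral F = (∫ x in Iic c, F (x + L.lower * Complex.I))
      + (∫ y in L.lower..L.upper, F (c + y * Complex.I) * Complex.I)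
      - ∫ x in Iic c, F (x + L.upper * Complex.I) := by
  -- The rectangle between the old and the new corner lies to the right of every pole, so Cauchy's
  -- theorem applies.
  have hd : DifferentiableOn ℂ F (uIcc c L.corner ×ℂ uIcc L.lower L.upper) := by
    intro s hs
    rw [hF]
    refine (differentiableAt_foxIntegrand _ A
      (mul_add_ne_neg_natCast_of_re_pos fun k => ?_) hz).differentiableWithinAt
    rw [uIcc_of_le hcL] at hs
    have h1 : c ≤ s.re := hs.1.1
    nlinarith [hc k, hB k]
  have h := Complex.integral_boundary_rect_eq_zero_of_differentiableOn F
    (c + L.lower * Complex.I) (L.corner + L.upper * Complex.I) (by simpa using hd)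
  simp only [Complex.add_re, Complex.ofReal_re, Complex.re_ofReal_mul, Complex.I_re, mul_zero,
    add_zero, Complex.add_im, Complex.ofReal_im, Complex.im_ofReal_mul, Complex.I_im, mul_one,
    zero_add, smul_eq_mul] at h
  have h1 := intervalIntegral.integral_Iic_sub_Iic
    (integrableOn_foxIntegrand_horizontal hA hB hAB hab hl hz hz' c)
    (integrableOn_foxIntegrand_horizontal hA hB hAB hab hl hz hz' L.corner)
  have h2 := intervalIntegral.integral_Iic_sub_Iic
    (integrableOn_foxIntegrand_horizontal hA hB hAB hab hu hz hz' c)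
    (integrableOn_foxIntegrand_horizontal hA hB hAB hab hu hz hz' L.corner)
  rw [← hF] at h1 h2
  rw [LeftLoop.integral, intervalIntegral.integral_mul_const, intervalIntegral.integral_mul_const]
  linear_combination h1 - h2 + h

theorem lintegral_Ioi_rpow_div {δ x : ℝ} (hδ : 0 < δ) (hx : x < 0) :
    ∫⁻ σ in Ioi (1 / δ), ENNReal.ofReal (σ ^ x / σ) = ENNReal.ofReal (δ ^ (-x) / (-x)) := by
  have h1 : 0 < 1 / δ := by positivity
  have h2 : ∀ σ ∈ Ioi (1 / δ), σ ^ x / σ = σ ^ (x - 1) := fun σ hσ =>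
    (Real.rpow_sub_one (h1.trans hσ).ne' x).symm
  rw [setLIntegral_congr_fun measurableSet_Ioi fun σ hσ => by rw [h2 σ hσ],
    ← ofReal_integral_eq_lintegral_ofReal (integrableOn_Ioi_rpow_of_lt (by linarith) h1),
    integral_Ioi_rpow_of_lt (by linarith) h1]
  · congr 1
    rw [sub_add_cancel, one_div, Real.inv_rpow hδ.le, ← Real.rpow_neg hδ.le, div_neg, neg_div]
  · filter_upwards [ae_restrict_mem measurableSet_Ioi] with σ hσ
    exact Real.rpow_nonneg (h1.trans hσ).le _

/-- Tonelli's theorem for the integral of `‖H(1/σ)‖ dσ/σ` over a piece of the contour. -/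
theorem lintegral_lintegral_foxIntegrand (a : Fin n → ℂ) (A : Fin n → ℝ) (b : Fin n → ℂ)
    (B : Fin n → ℝ) {δ : ℝ} (hδ : 0 < δ) (ν : Measure ℝ) [SFinite ν] {γ : ℝ → ℂ}
    (hγ : Measurable γ) (hre : ∀ᵐ p ∂ν, (γ p).re < 0) :
    ∫⁻ σ in Ioi (1 / δ), (∫⁻ p, ‖foxIntegrand a A b B (1 / σ) (γ p)‖ₑ ∂ν) *
        ENNReal.ofReal (1 / σ) =
      ∫⁻ p, ENNReal.ofReal (‖foxRatio a A b B (γ p)‖ * (δ ^ (-(γ p).re) / (-(γ p).re))) ∂ν := by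
  have hm : Measurable fun q : ℝ × ℝ => ‖foxIntegrand a A b B (1 / q.1) (γ q.2)‖ₑ := by
    simp only [foxIntegrand_eq]
    fun_prop
  have h1 : ∀ σ, (∫⁻ p, ‖foxIntegrand a A b B (1 / σ) (γ p)‖ₑ ∂ν) * ENNReal.ofReal (1 / σ) =
      ∫⁻ p, ‖foxIntegrand a A b B (1 / σ) (γ p)‖ₑ * ENNReal.ofReal (1 / σ) ∂ν := fun σ =>
    (lintegral_mul_const _ (hm.comp measurable_prodMk_left)).symm
  simp only [h1]
  rw [lintegral_lintegral_swap (by fun_prop)]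
  refine lintegral_congr_ae ?_
  filter_upwards [hre] with p hp
  rw [ENNReal.ofReal_mul (norm_nonneg _), ← lintegral_Ioi_rpow_div hδ hp,
    ← lintegral_const_mul _ (by fun_prop)]
  refine setLIntegral_congr_fun measurableSet_Ioi fun σ hσ => ?_
  have hσ0 : 0 < σ := lt_trans (by positivity) hσ
  rw [← ofReal_norm, norm_foxIntegrand _ _ _ _ (by positivity),
    ENNReal.ofReal_mul (norm_nonneg _), mul_assoc, ← ENNReal.ofReal_mul (by positivity)]
  rw [← div_eq_mul_one_div, one_div, Real.inv_rpow hσ0.le, ← Real.rpow_neg hσ0.le, neg_neg]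

theorem measurable_foxH (a : Fin n → ℂ) (A : Fin n → ℝ) (b : Fin n → ℂ) (B : Fin n → ℝ)
    (L : LeftLoop b B) : Measurable (foxH a A b B L) := by
  have h : ∀ (ν : Measure ℝ) [SFinite ν] (γ : ℝ → ℂ), Measurable γ →
      Measurable fun z : ℝ => ∫ p, foxIntegrand a A b B z (γ p) ∂ν := by
    intro ν _ γ hγ
    refine (StronglyMeasurable.integral_prod_right (Measurable.stronglyMeasurable ?_)).measurable
    simp only [Function.uncurry_def, foxIntegrand_eq]
    fun_prop
  have h1 := h (volume.restrict (Iic L.corner)) (fun x => x + L.lower * Complex.I) (by fun_prop)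
  have h2 := h (volume.restrict (Ioc L.lower L.upper)) (fun y => L.corner + y * Complex.I)
    (by fun_prop)
  have h3 := h (volume.restrict (Iic L.corner)) (fun x => x + L.upper * Complex.I) (by fun_prop)
  unfold foxH LeftLoop.integral
  simp only [intervalIntegral.integral_of_le L.lower_lt_upper.le, integral_mul_const]
  refine Measurable.ite measurableSet_Iio ?_ measurable_const
  exact Measurable.const_mul ((h1.add (h2.mul_const _)).sub h3) _

/-- The poles are real, so the horizontal half-lines stay off the real axis; `k` only guarantees
that there is a pole. -/
theorem LeftLoop.lower_neg (L : LeftLoop (fun k => (b k : ℂ)) B) (k : Fin n) :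
    L.lower < 0 := by
  have h := L.lower_lt_im_pole k 0
  have h2 : (-((b k : ℂ) + (0 : ℕ)) / (B k : ℂ)) = ((-b k / B k : ℝ) : ℂ) := by push_cast; ring
  rwa [h2, Complex.ofReal_im] at h

theorem LeftLoop.upper_pos (L : LeftLoop (fun k => (b k : ℂ)) B) (k : Fin n) :
    0 < L.upper := by
  have h := L.im_pole_lt_upper k 0
  have h2 : (-((b k : ℂ) + (0 : ℕ)) / (B k : ℂ)) = ((-b k / B k : ℝ) : ℂ) := by push_cast; ring
  rwa [h2, Complex.ofReal_im] at h

/-- The rightmost poles -b_k/B_k are negative, which leaves room for a negative corner. With Re s <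
0 on the whole loop, σ^{Re s} is integrable against dσ/σ at infinity. -/
theorem LeftLoop.exists_corner (hB : ∀ k, 0 < B k) (hb : ∀ k, 0 < b k)
    (L : LeftLoop (fun k => (b k : ℂ)) B) :
    ∃ c < 0, c ≤ L.corner ∧ ∀ k, 0 < B k * c + b k := by
  have h : ∀ k, -b k / B k < min 0 L.corner := by
    intro k
    refine lt_min (div_neg_of_neg_of_pos (by linarith [hb k]) (hB k)) ?_
    have h := L.re_pole_lt k 0
    have h2 : (-((b k : ℂ) + (0 : ℕ)) / (B k : ℂ)) = ((-b k / B k : ℝ) : ℂ) := by push_cast; ring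
    rwa [h2, Complex.ofReal_re] at h
  have h2 : ∀ᶠ c in nhdsWithin (min 0 L.corner) (Iio (min 0 L.corner)), ∀ k, -b k / B k < c :=
    Filter.eventually_all.2 fun k =>
      (lt_mem_nhds (h k)).filter_mono nhdsWithin_le_nhds
  obtain ⟨c, h3, h4⟩ := (h2.and self_mem_nhdsWithin).exists
  have h5 : c < min 0 L.corner := h4
  refine ⟨c, h5.trans_le (min_le_left _ _), (h5.trans_le (min_le_right _ _)).le, fun k => ?_⟩
  have h6 := h3 k
  rw [div_lt_iff₀ (hB k)] at h6
  linarith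

/-- The triangle inequality over the three sides of the moved loop, then Tonelli on each side. The
half-lines are controlled by the decay t^{-μ-1}, the vertical side by compactness. -/
theorem lintegral_foxH_lt_top (hA : ∀ k, 0 < A k) (hB : ∀ k, 0 < B k)
    (hAB : ∑ k, A k = ∑ k, B k) (hb : ∀ k, 0 < b k) (hab : 0 < ∑ k, a k - ∑ k, b k)
    (L : LeftLoop (fun k => (b k : ℂ)) B) :
    ∫⁻ σ in Ioi (1 / foxRadius A B),
      ‖foxH (fun k => (a k : ℂ)) A (fun k => (b k : ℂ)) B L (1 / σ)‖ₑ * ENNReal.ofReal (1 / σ) <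
        ∞ := by
  have hδ := foxRadius_pos hA hB
  set δ := foxRadius A B with hδdef
  -- For n = 0 both sums vanish, against `hab`.
  obtain ⟨k⟩ : Nonempty (Fin n) := by
    by_contra h
    rw [not_nonempty_iff] at h
    simp at hab
  have hl := L.lower_neg k
  have hu := L.upper_pos k
  obtain ⟨c, hc0, hcL, hc⟩ := L.exists_corner hB hb
  set F := fun z => foxIntegrand (fun k => (a k : ℂ)) A (fun k => (b k : ℂ)) B z with hF
  set G := fun s => ENNReal.ofReal (‖foxRatio (fun k => (a k : ℂ)) A (fun k => (b k : ℂ)) B s‖ *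
    (δ ^ (-s.re) / (-s.re))) with hG
  have hline : ∀ y : ℝ, y ≠ 0 → ∫⁻ x in Iic c, G (x + y * Complex.I) < ∞ := by
    intro y hy
    have h := integrableOn_norm_foxRatio_horizontal hA hB hAB hab hy hc0
    have h2 := h.lintegral_lt_top
    simpa [hG] using h2
  have hvert : ∫⁻ y in Ioc L.lower L.upper, G (c + y * Complex.I) < ∞ := by
    have hcont : Continuous fun y : ℝ => ‖foxRatio (fun k => (a k : ℂ)) A (fun k => (b k : ℂ)) B
        (c + y * Complex.I)‖ * (δ ^ (-c) / (-c)) := by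
      refine Continuous.mul (Continuous.norm ?_) continuous_const
      rw [continuous_iff_continuousAt]
      intro y
      exact ContinuousAt.comp (f := fun y : ℝ => (c + y * Complex.I : ℂ))
        (differentiableAt_foxRatio _ A
          (mul_add_ne_neg_natCast_of_re_pos (by simpa using hc))).continuousAt (by fun_prop)
    have h2 := (hcont.integrableOn_Ioc (a := L.lower) (b := L.upper)
      (μ := volume)).lintegral_lt_top
    simpa [hG] using h2
  set K : ℝ≥0∞ := ‖(2 * Real.pi * Complex.I)⁻¹‖ₑ with hK
  have hm : ∀ (ν : Measure ℝ) [SFinite ν] (γ : ℝ → ℂ), Measurable γ →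
      Measurable fun σ : ℝ => (∫⁻ p, ‖F (1 / σ) (γ p)‖ₑ ∂ν) * ENNReal.ofReal (1 / σ) := by
    intro ν _ γ hγ
    refine Measurable.mul (Measurable.lintegral_prod_right'
      (f := fun q : ℝ × ℝ => ‖F (1 / q.1) (γ q.2)‖ₑ) ?_) (by fun_prop)
    simp only [hF, foxIntegrand_eq]
    fun_prop
  have hbound : ∀ σ ∈ Ioi (1 / δ),
      ‖foxH (fun k => (a k : ℂ)) A (fun k => (b k : ℂ)) B L (1 / σ)‖ₑ * ENNReal.ofReal (1 / σ) ≤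
      K * ((∫⁻ x in Iic c, ‖F (1 / σ) (x + L.lower * Complex.I)‖ₑ) * ENNReal.ofReal (1 / σ) +
        (∫⁻ y in Ioc L.lower L.upper, ‖F (1 / σ) (c + y * Complex.I)‖ₑ) * ENNReal.ofReal (1 / σ) +
        (∫⁻ x in Iic c, ‖F (1 / σ) (x + L.upper * Complex.I)‖ₑ) * ENNReal.ofReal (1 / σ)) := by
    intro σ hσ
    have hσ0 : 0 < σ := lt_trans (by positivity) hσ
    have hσδ : 1 / σ < δ := (one_div_lt hδ hσ0).1 hσ
    rw [← add_mul, ← add_mul, ← mul_assoc]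
    gcongr
    rw [foxH, if_pos hσδ, enorm_mul]
    gcongr
    rw [L.integral_foxIntegrand_eq hA hB hAB hab.le hl.ne hu.ne' (by positivity) hσδ hc hcL rfl]
    refine (enorm_sub_le).trans (add_le_add ((enorm_add_le _ _).trans (add_le_add ?_ ?_)) ?_)
    · exact enorm_integral_le_lintegral_enorm _
    · rw [intervalIntegral.integral_of_le L.lower_lt_upper.le]
      refine (enorm_integral_le_lintegral_enorm _).trans (lintegral_mono fun y => ?_)
      rw [enorm_mul, ← ofReal_norm Complex.I]
      simp [hF]
    · exact enorm_integral_le_lintegral_enorm _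
  refine (setLIntegral_mono' measurableSet_Ioi hbound).trans_lt ?_
  have hre1 : ∀ y : ℝ, ∀ᵐ x : ℝ ∂(volume.restrict (Iic c)), (x + y * Complex.I : ℂ).re < 0 := by
    intro y
    filter_upwards [ae_restrict_mem measurableSet_Iic] with x hx
    have : x ≤ c := hx
    simpa using this.trans_lt hc0
  have hre2 : ∀ᵐ y : ℝ ∂(volume.restrict (Ioc L.lower L.upper)), (c + y * Complex.I : ℂ).re < 0 :=
    Filter.Eventually.of_forall fun y => by simpa using hc0
  have hm1 := fun y : ℝ => hm (volume.restrict (Iic c)) (fun x => x + y * Complex.I) (by fun_prop)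
  have hm2 := hm (volume.restrict (Ioc L.lower L.upper)) (fun y => c + y * Complex.I) (by fun_prop)
  have hsplit : ∀ f₁ f₂ f₃ : ℝ → ℝ≥0∞, Measurable f₁ → Measurable f₂ → Measurable f₃ →
      ∫⁻ σ in Ioi (1 / δ), K * (f₁ σ + f₂ σ + f₃ σ) = K * ((∫⁻ σ in Ioi (1 / δ), f₁ σ) +
        (∫⁻ σ in Ioi (1 / δ), f₂ σ) + ∫⁻ σ in Ioi (1 / δ), f₃ σ) := by
    intro f₁ f₂ f₃ h₁ h₂ h₃
    rw [lintegral_const_mul _ (by fun_prop), lintegral_add_left (by fun_prop),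
      lintegral_add_left h₁]
  refine lt_of_eq_of_lt (hsplit _ _ _ (hm1 L.lower) hm2 (hm1 L.upper)) ?_
  refine ENNReal.mul_lt_top enorm_lt_top (ENNReal.add_lt_top.2 ⟨ENNReal.add_lt_top.2
    ⟨?_, ?_⟩, ?_⟩)
  · exact (lintegral_lintegral_foxIntegrand _ _ _ _ hδ _
      (by fun_prop) (hre1 L.lower)).trans_lt (hline _ hl.ne)
  · exact (lintegral_lintegral_foxIntegrand _ _ _ _ hδ _ (by fun_prop) hre2).trans_lt hvert
  · exact (lintegral_lintegral_foxIntegrand _ _ _ _ hδ _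
      (by fun_prop) (hre1 L.upper)).trans_lt (hline _ hu.ne')

end FoxH

/-! ### Finiteness of the constant for the kernel of K -/

theorem measurable_kernelK {n : ℕ} (ε ξ τ α : Fin n → ℝ) (L : KLoop ξ τ) :
    Measurable (kernelK ε ξ τ α L) :=
  (measurable_foxH _ _ _ _ L).comp (by fun_prop)

/-- The kernel vanishes for 1/σ ≥ δ, so only σ > 1/δ contributes, whether δ is above or below 1. -/
theorem integrableOn_norm_kernelK_div {n : ℕ} {ε ξ α τ : Fin n → ℝ}
    (hε : ∀ k, 0 < ε k) (hξ : ∀ k, 0 < ξ k) (h_sum : ∑ k, 1 / ξ k = ∑ k, 1 / ε k)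
    (hα_sum : 0 < ∑ k, α k) (hτ : ∀ k, -1 < τ k * ξ k) (L : KLoop ξ τ) :
    IntegrableOn (fun σ : ℝ => ‖kernelK ε ξ τ α L σ‖ / σ) (Ioi 1) := by
  have hm := measurable_kernelK ε ξ τ α L
  refine ⟨(by fun_prop : Measurable _).aestronglyMeasurable, ?_⟩
  rw [hasFiniteIntegral_iff_enorm]
  have hA : ∀ k, 0 < 1 / ε k := fun k => one_div_pos.2 (hε k)
  have hB : ∀ k, 0 < 1 / ξ k := fun k => one_div_pos.2 (hξ k)
  have hδ := foxRadius_pos hA hB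
  -- The condition τ_k ξ_k > -1 says exactly that b_k > 0, that is, that the poles are negative.
  have hb : ∀ k, 0 < τ k + 1 / ξ k := fun k => by
    have h : τ k + 1 / ξ k = (τ k * ξ k + 1) / ξ k := by
      have := (hξ k).ne'
      field_simp
    rw [h]
    exact div_pos (by linarith [hτ k]) (hξ k)
  refine lt_of_le_of_lt ?_ (lintegral_foxH_lt_top (a := fun k => τ k + α k + 1 / ε k)
    (b := fun k => τ k + 1 / ξ k) hA hB h_sum.symm hb ?_ L)
  · rw [← lintegral_indicator measurableSet_Ioi, ← lintegral_indicator measurableSet_Ioi]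
    refine lintegral_mono fun σ => ?_
    by_cases hσ1 : σ ∈ Ioi (1 : ℝ)
    · have hσ0 : 0 < σ := lt_trans one_pos hσ1
      rw [indicator_of_mem hσ1]
      by_cases hσ : σ ∈ Ioi (1 / foxRadius (fun k => 1 / ε k) fun k => 1 / ξ k)
      · rw [indicator_of_mem hσ, ← ofReal_norm, norm_div, norm_norm, Real.norm_of_nonneg hσ0.le,
          div_eq_mul_one_div, ENNReal.ofReal_mul (norm_nonneg _), ofReal_norm, kernelK]
      · have h : ¬ 1 / σ < foxRadius (fun k => 1 / ε k) fun k => 1 / ξ k := fun h =>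
          hσ ((one_div_lt hσ0 hδ).1 h)
        have h0 : kernelK ε ξ τ α L σ = 0 := if_neg h
        simp [h0]
    · rw [indicator_of_notMem hσ1]
      exact zero_le
  · simp only [Finset.sum_add_distrib, h_sum]
    linarith

/-! ### Continuity of translations on Schwartz space -/

section Translation

/-- The weight sits at x and the derivative at a nearby y, as the mean value inequality between x -
h and x requires. -/
theorem abs_pow_mul_norm_iteratedDeriv_add_le (φ : 𝓢(ℝ, ℂ)) (k l : ℕ) :
    ∃ K : ℝ, ∀ x y : ℝ, |x - y| ≤ 1 → |x| ^ k * ‖iteratedDeriv l φ y‖ ≤ K := by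
  refine ⟨2 ^ k * (2 ^ k * (Finset.Iic (k, l)).sup
    (fun m => SchwartzMap.seminorm ℝ m.1 m.2) φ), fun x y hxy => ?_⟩
  have h := SchwartzMap.one_add_le_sup_seminorm_apply (𝕜 := ℝ) (m := (k, l)) le_rfl le_rfl φ y
  rw [norm_iteratedFDeriv_eq_norm_iteratedDeriv] at h
  have h1 : |x| ≤ 2 * (1 + ‖y‖) := by
    rw [Real.norm_eq_abs]
    have := abs_sub_abs_le_abs_sub x y
    linarith [abs_nonneg y]
  calc |x| ^ k * ‖iteratedDeriv l φ y‖ ≤ (2 * (1 + ‖y‖)) ^ k * ‖iteratedDeriv l φ y‖ := by gcongr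
    _ = 2 ^ k * ((1 + ‖y‖) ^ k * ‖iteratedDeriv l φ y‖) := by rw [mul_pow]; ring
    _ ≤ _ := by gcongr

theorem exists_seminorm_compSubConstCLM_sub_le (φ : 𝓢(ℝ, ℂ)) (k l : ℕ) :
    ∃ K : ℝ, 0 ≤ K ∧ ∀ h : ℝ, |h| ≤ 1 →
      SchwartzMap.seminorm ℂ k l (φ.compSubConstCLM ℂ h - φ) ≤ K * |h| := by
  obtain ⟨K, hK⟩ := abs_pow_mul_norm_iteratedDeriv_add_le φ k (l + 1)
  have hK0 : 0 ≤ K := le_trans (by positivity) (hK 0 0 (by simp))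
  refine ⟨K, hK0, fun h hh => ?_⟩
  refine SchwartzMap.seminorm_le_bound' ℂ k l _ (by positivity) fun x => ?_
  have hφ : ContDiff ℝ l φ := φ.smooth l
  have h1 : iteratedDeriv l (φ.compSubConstCLM ℂ h - φ : 𝓢(ℝ, ℂ)) x =
      iteratedDeriv l φ (x - h) - iteratedDeriv l φ x := by
    have h2 : ((φ.compSubConstCLM ℂ h - φ : 𝓢(ℝ, ℂ)) : ℝ → ℂ) =
        (fun y => φ (y - h)) - φ := rfl
    rw [h2, iteratedDeriv_sub, iteratedDeriv_comp_sub_const]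
    · exact (hφ.comp (contDiff_id.sub contDiff_const)).contDiffAt
    · exact hφ.contDiffAt
  rw [h1]
  have hd : ∀ y, HasDerivAt (iteratedDeriv l φ) (iteratedDeriv (l + 1) φ y) y := by
    intro y
    rw [iteratedDeriv_succ]
    exact ((φ.smooth (l + 1)).differentiable_iteratedDeriv l
      (by exact_mod_cast Nat.lt_succ_self l) y).hasDerivAt
  have h3 := (convex_closedBall x 1).norm_image_sub_le_of_norm_hasDerivWithin_le
    (f := fun y => (|x| ^ k : ℝ) • iteratedDeriv l φ y)
    (f' := fun y => (|x| ^ k : ℝ) • iteratedDeriv (l + 1) φ y) (C := K)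
    (fun y _ => ((hd y).fun_const_smul _).hasDerivWithinAt)
    (fun y hy => by
      rw [norm_smul, Real.norm_of_nonneg (by positivity)]
      refine hK x y ?_
      rwa [abs_sub_comm, ← Real.dist_eq])
    (Metric.mem_closedBall_self zero_le_one) (show x - h ∈ Metric.closedBall x 1 by
      simpa [Real.dist_eq] using hh)
  rw [← smul_sub, norm_smul, Real.norm_of_nonneg (by positivity)] at h3
  simpa using h3

/-- The group law reduces continuity to the point 0. It makes f * φ a continuous function, so that
values at single points are meaningful. -/
theorem continuous_compSubConstCLM (φ : 𝓢(ℝ, ℂ)) :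
    Continuous fun x : ℝ => φ.compSubConstCLM ℂ x := by
  have h0 : ∀ ψ : 𝓢(ℝ, ℂ), Filter.Tendsto (fun x : ℝ => ψ.compSubConstCLM ℂ x) (nhds 0)
      (nhds ψ) := by
    intro ψ
    rw [(schwartz_withSeminorms ℂ ℝ ℂ).tendsto_nhds]
    rintro ⟨k, l⟩ ε hε
    obtain ⟨K, hK0, hK⟩ := exists_seminorm_compSubConstCLM_sub_le ψ k l
    have h1 : Filter.Tendsto (fun x : ℝ => K * |x|) (nhds 0) (nhds 0) := by
      have : Continuous fun x : ℝ => K * |x| := by fun_prop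
      simpa using this.tendsto 0
    have h2 : ∀ᶠ x : ℝ in nhds 0, |x| ≤ 1 := by
      filter_upwards [Metric.closedBall_mem_nhds (0 : ℝ) one_pos] with x hx
      simpa using hx
    filter_upwards [h2, h1.eventually (gt_mem_nhds hε)] with x hx1 hx2
    exact (hK x hx1).trans_lt hx2
  rw [continuous_iff_continuousAt]
  intro x₀
  have h1 : Filter.Tendsto (fun x : ℝ => x - x₀) (nhds x₀) (nhds 0) := by
    have : Continuous fun x : ℝ => x - x₀ := by fun_prop
    simpa using this.tendsto x₀
  refine ((h0 (φ.compSubConstCLM ℂ x₀)).comp h1).congr fun x => ?_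
  simp

theorem schwartzReflect_apply (φ : 𝓢(ℝ, ℂ)) (x : ℝ) : schwartzReflect φ x = φ (-x) := rfl

theorem schwartzReflect_schwartzReflect (φ : 𝓢(ℝ, ℂ)) :
    schwartzReflect (schwartzReflect φ) = φ := by
  ext x
  simp [schwartzReflect_apply]

theorem distribConv_schwartzReflect (f : 𝓢'(ℝ, ℂ)) (φ : 𝓢(ℝ, ℂ)) (x : ℝ) :
    distribConv f (schwartzReflect φ) x = f (φ.compSubConstCLM ℂ x) := by
  rw [distribConv, schwartzReflect_schwartzReflect]

theorem continuous_distribConv (f : 𝓢'(ℝ, ℂ)) (φ : 𝓢(ℝ, ℂ)) : Continuous (distribConv f φ) :=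
  (show Continuous f from f.cont).comp (continuous_compSubConstCLM _)

end Translation

/-! ### The Poisson kernel as an approximate identity -/

section PoissonKernel

theorem poissonKernelLine_eq (t x : ℝ) :
    poissonKernelLine t x = t⁻¹ * (Real.pi⁻¹ * (1 + (x / t) ^ 2)⁻¹) := by
  simp [poissonKernelLine, sq_abs]

@[fun_prop]
theorem continuous_poissonKernelLine (t : ℝ) : Continuous (poissonKernelLine t) := by
  simp only [funext (poissonKernelLine_eq t)]
  refine continuous_const.mul (continuous_const.mul (Continuous.inv₀ (by fun_prop) fun x => ?_))
  positivity

theorem poissonKernelLine_neg (t x : ℝ) : poissonKernelLine t (-x) = poissonKernelLine t x := by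
  simp [poissonKernelLine_eq, neg_div]

theorem poissonKernelLine_nonneg {t : ℝ} (ht : 0 < t) (x : ℝ) : 0 ≤ poissonKernelLine t x := by
  rw [poissonKernelLine_eq]
  have := Real.pi_pos
  positivity

theorem poissonKernelLine_le {t : ℝ} (ht : 0 < t) (x : ℝ) :
    poissonKernelLine t x ≤ t⁻¹ * Real.pi⁻¹ := by
  rw [poissonKernelLine_eq]
  have := Real.pi_pos
  have h : (1 + (x / t) ^ 2)⁻¹ ≤ 1 := inv_le_one_of_one_le₀ (by nlinarith [sq_nonneg (x / t)])
  gcongr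
  exact mul_le_of_le_one_right (by positivity) h

theorem norm_poissonKernelLine_le {t : ℝ} (ht : 0 < t) (x : ℝ) :
    ‖(poissonKernelLine t x : ℂ)‖ ≤ t⁻¹ * Real.pi⁻¹ := by
  rw [Complex.norm_of_nonneg (poissonKernelLine_nonneg ht x)]
  exact poissonKernelLine_le ht x

theorem poissonKernelLine_mul {t : ℝ} (ht : 0 < t) {u : ℝ} (hu : 0 < u) (x : ℝ) :
    u * poissonKernelLine (t * u) (x * u) = poissonKernelLine t x := by
  rw [poissonKernelLine_eq, poissonKernelLine_eq, mul_div_mul_right _ _ hu.ne', mul_inv]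
  field_simp

theorem integrable_poissonKernelLine_one : Integrable (poissonKernelLine 1) := by
  have h : poissonKernelLine 1 = fun x => Real.pi⁻¹ * (1 + x ^ 2)⁻¹ := by
    ext x; simp [poissonKernelLine_eq]
  rw [h]
  exact integrable_inv_one_add_sq.const_mul _

theorem integral_poissonKernelLine_one : ∫ x, poissonKernelLine 1 x = 1 := by
  have h : poissonKernelLine 1 = fun x => Real.pi⁻¹ * (1 + x ^ 2)⁻¹ := by
    ext x; simp [poissonKernelLine_eq]
  rw [h, integral_const_mul, integral_univ_inv_one_add_sq, inv_mul_cancel₀ Real.pi_ne_zero]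

theorem poissonKernelLine_eq_one_div {t : ℝ} (x : ℝ) :
    poissonKernelLine t x = t⁻¹ * poissonKernelLine 1 (x * t⁻¹) := by
  simp [poissonKernelLine_eq, div_eq_mul_inv]

theorem integrable_poissonKernelLine {t : ℝ} (ht : 0 < t) : Integrable (poissonKernelLine t) := by
  simp only [funext fun x => poissonKernelLine_eq_one_div (t := t) x]
  exact (integrable_poissonKernelLine_one.comp_mul_right' (inv_ne_zero ht.ne')).const_mul _

theorem integral_mul_poissonKernelLine (D : ℝ → ℂ) {t : ℝ} (ht : 0 < t) :
    ∫ y, D y * (poissonKernelLine t y : ℂ) = ∫ y, D (t * y) * (poissonKernelLine 1 y : ℂ) := by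
  have h := Measure.integral_comp_mul_right
    (fun y => D (t * y) * (poissonKernelLine 1 y : ℂ)) t⁻¹
  rw [inv_inv, abs_of_pos ht] at h
  have h2 : ∫ y, D y * (poissonKernelLine t y : ℂ) =
      (t⁻¹ : ℝ) • ∫ y, D (t * (y * t⁻¹)) * (poissonKernelLine 1 (y * t⁻¹) : ℂ) := by
    rw [← integral_smul]
    congr 1
    ext y
    have h3 : t * (y * t⁻¹) = y := by field_simp
    rw [h3, poissonKernelLine_eq_one_div, Complex.real_smul]
    push_cast
    ring
  rw [h2, h, smul_smul, inv_mul_cancel₀ ht.ne', one_smul]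

/-- Rescaling moves t from the kernel into D(ty); dominated convergence then applies since D is
bounded and continuous. -/
theorem tendsto_integral_mul_poissonKernelLine {D : ℝ → ℂ} (hD : Continuous D) {C : ℝ}
    (hC : ∀ x, ‖D x‖ ≤ C) :
    Filter.Tendsto (fun t : ℝ => ∫ y, D y * (poissonKernelLine t y : ℂ))
      (nhdsWithin 0 (Ioi 0)) (nhds (D 0)) := by
  have h0 : ∫ y, D 0 * (poissonKernelLine 1 y : ℂ) = D 0 := by
    rw [integral_const_mul, integral_complex_ofReal, integral_poissonKernelLine_one]
    simp
  have h1 : Filter.Tendsto (fun t : ℝ => ∫ y, D (t * y) * (poissonKernelLine 1 y : ℂ))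
      (nhdsWithin 0 (Ioi 0)) (nhds (∫ y, D 0 * (poissonKernelLine 1 y : ℂ))) := by
    refine tendsto_integral_filter_of_dominated_convergence
      (fun y => C * poissonKernelLine 1 y) ?_ ?_ ?_ ?_
    · refine Filter.Eventually.of_forall fun t => Continuous.aestronglyMeasurable ?_
      fun_prop
    · refine Filter.Eventually.of_forall fun t => Filter.Eventually.of_forall fun y => ?_
      rw [norm_mul, Complex.norm_of_nonneg (poissonKernelLine_nonneg one_pos y)]
      exact mul_le_mul_of_nonneg_right (hC _) (poissonKernelLine_nonneg one_pos y)
    · exact integrable_poissonKernelLine_one.const_mul _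
    · refine Filter.Eventually.of_forall fun y => Filter.Tendsto.mul_const _ ?_
      have : Continuous fun t : ℝ => D (t * y) := by fun_prop
      simpa using (this.tendsto 0).mono_left nhdsWithin_le_nhds
  rw [h0] at h1
  refine h1.congr' ?_
  filter_upwards [self_mem_nhdsWithin] with t ht
  exact (integral_mul_poissonKernelLine D ht).symm

/-- Smooth compactly supported functions are Schwartz, so u = v almost everywhere, hence everywhere
by continuity. -/
theorem IsPoissonConv.unique {t : ℝ} {f : 𝓢'(ℝ, ℂ)} {u v : ℝ →ᵇ ℂ} (hu : IsPoissonConv t f u)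
    (hv : IsPoissonConv t f v) : u = v := by
  have h : ∀ᵐ x : ℝ, u x = v x := by
    refine ae_eq_of_integral_contDiff_smul_eq u.continuous.locallyIntegrable
      v.continuous.locallyIntegrable fun g hg hgs => ?_
    have h1 : HasCompactSupport fun x => (g x : ℂ) := hgs.comp_left (g := fun x : ℝ => (x : ℂ)) (by simp)
    have h2 : ∫ x, u x * (g x : ℂ) = ∫ x, v x * (g x : ℂ) :=
      (hu (h1.toSchwartzMap (Complex.ofRealCLM.contDiff.comp hg))).trans (hv _).symm
    simpa [mul_comm] using h2
  have h2 := (u.continuous.ae_eq_iff_eq volume v.continuous).1 h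
  exact DFunLike.coe_injective h2

theorem isPoissonConv_poissonConv {t : ℝ} {f : 𝓢'(ℝ, ℂ)} (h : ∃ u, IsPoissonConv t f u) :
    IsPoissonConv t f (poissonConv t f) := by
  rw [poissonConv, dif_pos h]
  exact h.choose_spec

theorem measurable_poissonMaximal (f : 𝓢'(ℝ, ℂ)) : Measurable (poissonMaximal f) := by
  refine LowerSemicontinuous.measurable ?_
  refine lowerSemicontinuous_iSup fun t => lowerSemicontinuous_iSup fun _ => ?_
  exact (continuous_enorm.comp (poissonConv t f).continuous).lowerSemicontinuous

end PoissonKernel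

/-! ### Elements of H¹ are integrable functions -/

section HardyEmbedding

/-- By continuity, the set where the essential bound fails is open; being null, it is empty. -/
theorem exists_norm_distribConv_le {f : 𝓢'(ℝ, ℂ)} (hf : IsBoundedDistribution f) (φ : 𝓢(ℝ, ℂ)) :
    ∃ C : ℝ, ∀ x, ‖distribConv f φ x‖ ≤ C := by
  obtain ⟨C, hC⟩ : ∃ C : ℝ, ∀ᵐ x, ‖distribConv f φ x‖ ≤ C := by
    refine ⟨(eLpNormEssSup (distribConv f φ) volume).toReal, ?_⟩
    filter_upwards [ae_le_eLpNormEssSup (f := distribConv f φ) (μ := volume)] with x hx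
    rw [← toReal_enorm]
    exact ENNReal.toReal_mono (by simpa using (hf φ).2.ne) hx
  refine ⟨C, ?_⟩
  have h1 : IsOpen {x | C < ‖distribConv f φ x‖} :=
    isOpen_lt continuous_const (continuous_distribConv f φ).norm
  have h2 : volume {x | C < ‖distribConv f φ x‖} = 0 := by
    rw [ae_iff] at hC
    simpa using hC
  rw [h1.measure_eq_zero_iff volume] at h2
  intro x
  by_contra! hx
  exact (h2 ▸ hx : x ∈ (∅ : Set ℝ))

/-- With φ̃(x) = φ(-x), f(φ) = (f * φ̃)(0) is the limit as t → 0 of ∫ (f * φ̃) P_t = ∫ (P_t * f) φ,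
and |P_t * f| ≤ M_P f for every t. -/
theorem MemH1.enorm_apply_le {f : 𝓢'(ℝ, ℂ)} (hf : MemH1 f) (φ : 𝓢(ℝ, ℂ)) :
    ‖f φ‖ₑ ≤ ∫⁻ x, ‖φ x‖ₑ * poissonMaximal f x := by
  obtain ⟨C, hC⟩ := exists_norm_distribConv_le hf.bounded (schwartzReflect φ)
  have h1 := tendsto_integral_mul_poissonKernelLine
    (continuous_distribConv f (schwartzReflect φ)) hC
  rw [distribConv_schwartzReflect, compSubConstCLM_zero, ContinuousLinearMap.id_apply] at h1
  refine le_of_tendsto h1.enorm ?_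
  filter_upwards [self_mem_nhdsWithin] with t ht
  have h2 := isPoissonConv_poissonConv (hf.exists_poissonConv t ht) φ
  simp only [poissonKernelLine_neg] at h2
  rw [← h2]
  refine (enorm_integral_le_lintegral_enorm _).trans (lintegral_mono fun x => ?_)
  rw [enorm_mul, mul_comm]
  gcongr
  exact le_iSup₂_of_le t ht le_rfl

/-- Let μ = M_P f dx, a finite measure. By `MemH1.enorm_apply_le` and Cauchy-Schwarz, f is bounded
for the L²(μ) norm; Hahn-Banach and Riesz give w ∈ L²(μ) with f(φ) = ∫ φ w̄ dμ. Since L²(μ) ⊆ L¹(μ),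
the density w̄ M_P f is Lebesgue integrable. -/
theorem MemH1.exists_integrable {f : 𝓢'(ℝ, ℂ)} (hf : MemH1 f) :
    ∃ g : ℝ → ℂ, Integrable g ∧ ∀ φ : 𝓢(ℝ, ℂ), f φ = ∫ x, φ x * g x := by
  have hm := measurable_poissonMaximal f
  have hfin := hf.lintegral_lt_top
  set M := poissonMaximal f
  set μ := (volume : Measure ℝ).withDensity M with hμ
  have hμfin : IsFiniteMeasure μ := isFiniteMeasure_withDensity hfin.ne
  have hlt : ∀ᵐ x : ℝ, M x < ∞ := ae_lt_top hm hfin.ne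
  let T : 𝓢(ℝ, ℂ) →ₗ[ℂ] Lp ℂ 2 μ := (toLpCLM ℂ ℂ 2 μ).toLinearMap
  have hT : ∀ φ, T φ =ᵐ[μ] φ := fun φ => φ.coeFn_toLp 2 μ
  -- The exponent is 1 - 1/2: c is the Cauchy-Schwarz constant μ(ℝ)^{1/2}.
  set c := (μ univ).toReal ^ (1 / (1 : ℝ≥0∞).toReal - 1 / (2 : ℝ≥0∞).toReal) with hc
  have hbound : ∀ φ, ‖f φ‖ ≤ c * ‖T φ‖ := by
    intro φ
    have h1 : ‖f φ‖ₑ ≤ eLpNorm (T φ) 1 μ := by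
      refine (hf.enorm_apply_le φ).trans_eq ?_
      have h2 : ∫⁻ x, ‖T φ x‖ₑ ∂μ = ∫⁻ x, ‖φ x‖ₑ ∂μ :=
        lintegral_congr_ae ((hT φ).fun_comp (fun z => ‖z‖ₑ))
      rw [eLpNorm_one_eq_lintegral_enorm, h2]
      refine Eq.trans ?_ (lintegral_withDensity_eq_lintegral_mul volume hm
        (g := fun x => ‖φ x‖ₑ) (by fun_prop)).symm
      simp [M, mul_comm]
    have h2 := h1.trans (eLpNorm_le_eLpNorm_mul_rpow_measure_univ (p := 1) (q := 2)
      (by norm_num) (Lp.aestronglyMeasurable (T φ)))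
    have h3 := ENNReal.toReal_mono (ENNReal.mul_ne_top (Lp.memLp (T φ)).2.ne
      (ENNReal.rpow_ne_top_of_nonneg (by norm_num) (measure_ne_top μ univ))) h2
    rw [toReal_enorm, ENNReal.toReal_mul, ← ENNReal.toReal_rpow, mul_comm] at h3
    exact h3
  -- Passing to classes modulo μ-null sets need not be injective, so f is factored through the
  -- kernel to define it on the range of `T`.
  have hker : LinearMap.ker T ≤ LinearMap.ker (f : 𝓢(ℝ, ℂ) →ₗ[ℂ] ℂ) := by
    intro φ hφ
    rw [LinearMap.mem_ker] at hφ ⊢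
    have h := hbound φ
    rw [hφ, norm_zero, mul_zero] at h
    exact norm_le_zero_iff.1 h
  let ℓ₀ : LinearMap.range T →ₗ[ℂ] ℂ :=
    ((LinearMap.ker T).liftQ (f : 𝓢(ℝ, ℂ) →ₗ[ℂ] ℂ) hker).comp
      T.quotKerEquivRange.symm.toLinearMap
  have hℓ₀ : ∀ φ, ℓ₀ ⟨T φ, φ, rfl⟩ = f φ := by
    intro φ
    have h : T.quotKerEquivRange.symm ⟨T φ, φ, rfl⟩ = (LinearMap.ker T).mkQ φ := by
      rw [LinearEquiv.symm_apply_eq]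
      rfl
    change ((LinearMap.ker T).liftQ (f : 𝓢(ℝ, ℂ) →ₗ[ℂ] ℂ) hker) (T.quotKerEquivRange.symm _) = _
    rw [h]
    rfl
  let ℓ₁ : StrongDual ℂ (LinearMap.range T) := ℓ₀.mkContinuous c (by
    rintro ⟨_, φ, rfl⟩
    rw [hℓ₀]
    exact hbound φ)
  obtain ⟨ℓ, hℓ, -⟩ := exists_extension_norm_eq (LinearMap.range T) ℓ₁
  set w := (InnerProductSpace.toDual ℂ (Lp ℂ 2 μ)).symm ℓ with hw
  have hw1 : Integrable (fun x => (starRingEnd ℂ) (w x)) μ := by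
    have := (Lp.memLp w).integrable (by norm_num)
    exact (Complex.conjLIE.toContinuousLinearEquiv.toContinuousLinearMap.integrable_comp this)
  refine ⟨fun x => (M x).toReal • (starRingEnd ℂ) (w x),
    (integrable_withDensity_iff_integrable_smul' hm hlt).1 hw1, fun φ => ?_⟩
  have h1 : f φ = ℓ (T φ) := by
    rw [← hℓ₀ φ]
    exact (hℓ ⟨T φ, φ, rfl⟩).symm
  have h2 : ℓ (T φ) = inner ℂ w (T φ) := by
    rw [hw, InnerProductSpace.toDual_symm_apply]
  rw [h1, h2, L2.inner_def]
  have h3 : ∫ x, inner ℂ (w x) (T φ x) ∂μ = ∫ x, φ x * (starRingEnd ℂ) (w x) ∂μ := by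
    refine integral_congr_ae ?_
    filter_upwards [hT φ] with x hx
    rw [hx, RCLike.inner_apply]
  rw [h3]
  refine (integral_withDensity_eq_integral_toReal_smul hm hlt _).trans ?_
  congr 1
  ext x
  rw [mul_smul_comm]

theorem MemH1.exists_toTemperedDistribution_eq {f : 𝓢'(ℝ, ℂ)} (hf : MemH1 f) :
    ∃ g : Lp ℂ 1 (volume : Measure ℝ), Lp.toTemperedDistribution g = f := by
  obtain ⟨g, hg, hgf⟩ := hf.exists_integrable
  refine ⟨(memLp_one_iff_integrable.2 hg).toLp g, ?_⟩
  ext φ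
  rw [Lp.toTemperedDistribution_apply, hgf]
  refine integral_congr_ae ?_
  filter_upwards [(memLp_one_iff_integrable.2 hg).coeFn_toLp] with x hx
  rw [hx, smul_eq_mul]

end HardyEmbedding

/-! ### Poisson integrals of integrable functions -/

section PoissonIntegral

/-- The Poisson integral `∫ P_t(x - y) g(y) dy`. -/
noncomputable def poissonIntegral (t : ℝ) (g : ℝ → ℂ) (x : ℝ) : ℂ :=
  ∫ y, (poissonKernelLine t (x - y) : ℂ) * g y

theorem integrable_poissonKernelLine_mul {t : ℝ} (ht : 0 < t) {g : ℝ → ℂ} (hg : Integrable g)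
    (x : ℝ) : Integrable fun y => (poissonKernelLine t (x - y) : ℂ) * g y :=
  hg.bdd_mul (c := t⁻¹ * Real.pi⁻¹) (Continuous.aestronglyMeasurable (by fun_prop))
    (Filter.Eventually.of_forall fun y => norm_poissonKernelLine_le ht _)

theorem norm_poissonIntegral_le {t : ℝ} (ht : 0 < t) {g : ℝ → ℂ} (hg : Integrable g) (x : ℝ) :
    ‖poissonIntegral t g x‖ ≤ t⁻¹ * Real.pi⁻¹ * ∫ y, ‖g y‖ := by
  rw [← integral_const_mul]
  refine norm_integral_le_of_norm_le (hg.norm.const_mul _) (Filter.Eventually.of_forall fun y => ?_)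
  rw [norm_mul]
  gcongr
  exact norm_poissonKernelLine_le ht _

theorem continuous_poissonIntegral {t : ℝ} (ht : 0 < t) {g : ℝ → ℂ} (hg : Integrable g) :
    Continuous (poissonIntegral t g) := by
  refine continuous_of_dominated (bound := fun y => t⁻¹ * Real.pi⁻¹ * ‖g y‖)
    (fun x => (integrable_poissonKernelLine_mul ht hg x).aestronglyMeasurable)
    (fun x => Filter.Eventually.of_forall fun y => ?_) (hg.norm.const_mul _)
    (Filter.Eventually.of_forall fun y => by fun_prop)
  rw [norm_mul]
  gcongr
  exact norm_poissonKernelLine_le ht _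

variable {f : 𝓢'(ℝ, ℂ)} {g : ℝ → ℂ}

theorem distribConv_eq_integral (hf : ∀ φ : 𝓢(ℝ, ℂ), f φ = ∫ x, φ x * g x) (φ : 𝓢(ℝ, ℂ)) (x : ℝ) :
    distribConv f φ x = ∫ y, φ (x - y) * g y := by
  rw [distribConv, hf]
  simp [schwartzReflect_apply]

theorem exists_norm_schwartz_le (φ : 𝓢(ℝ, ℂ)) : ∃ C : ℝ, ∀ x, ‖φ x‖ ≤ C :=
  ⟨SchwartzMap.seminorm ℝ 0 0 φ, fun x => φ.norm_le_seminorm ℝ x⟩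

theorem isBoundedDistribution_of_integrable (hg : Integrable g)
    (hf : ∀ φ : 𝓢(ℝ, ℂ), f φ = ∫ x, φ x * g x) : IsBoundedDistribution f := by
  intro φ
  obtain ⟨C, hC⟩ := exists_norm_schwartz_le φ
  refine memLp_top_of_bound (continuous_distribConv f φ).aestronglyMeasurable (C * ∫ y, ‖g y‖)
    (Filter.Eventually.of_forall fun x => ?_)
  rw [distribConv_eq_integral hf, ← integral_const_mul]
  refine norm_integral_le_of_norm_le (hg.norm.const_mul _) (Filter.Eventually.of_forall fun y => ?_)
  rw [norm_mul]
  gcongr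
  exact hC _

/-- Both sides are the double integral of φ(x) P_t(x - z) g(z); the substitution y = z - x and two
uses of Fubini connect them. -/
theorem isPoissonConv_poissonIntegral (hg : Integrable g)
    (hf : ∀ φ : 𝓢(ℝ, ℂ), f φ = ∫ x, φ x * g x) {t : ℝ} (ht : 0 < t) {u : ℝ →ᵇ ℂ}
    (hu : ∀ x, u x = poissonIntegral t g x) : IsPoissonConv t f u := by
  intro φ
  obtain ⟨C, hC⟩ := exists_norm_schwartz_le φ
  have h1 : Integrable (fun p : ℝ × ℝ => φ p.1 * ((poissonKernelLine t (p.1 - p.2) : ℂ) * g p.2))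
      (volume.prod volume) := by
    have h := (φ.integrable (μ := volume)).mul_prod hg
    refine (h.bdd_mul (c := t⁻¹ * Real.pi⁻¹)
      (f := fun p : ℝ × ℝ => (poissonKernelLine t (p.1 - p.2) : ℂ))
      (Continuous.aestronglyMeasurable (by fun_prop))
      (Filter.Eventually.of_forall fun p => norm_poissonKernelLine_le ht _)).congr
      (Filter.Eventually.of_forall fun p => ?_)
    ring
  have h2 : Integrable (fun p : ℝ × ℝ => φ (p.2 - p.1) * g p.2 * (poissonKernelLine t p.1 : ℂ))
      (volume.prod volume) := by
    have h := (integrable_poissonKernelLine ht).ofReal (𝕜 := ℂ) |>.mul_prod hg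
    refine (h.bdd_mul (c := C) (f := fun p : ℝ × ℝ => φ (p.2 - p.1))
      (Continuous.aestronglyMeasurable (φ.continuous.comp (by fun_prop)))
      (Filter.Eventually.of_forall fun p => hC _)).congr
      (Filter.Eventually.of_forall fun p => ?_)
    simp only [RCLike.ofReal_eq_complex_ofReal]
    ring
  have h3 : ∀ z : ℝ, ∫ y, φ (z - y) * g z * (poissonKernelLine t y : ℂ) =
      ∫ x, φ x * ((poissonKernelLine t (x - z) : ℂ) * g z) := by
    intro z
    rw [← integral_sub_left_eq_self (fun x => φ x * ((poissonKernelLine t (x - z) : ℂ) * g z))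
      volume z]
    congr 1
    ext y
    rw [sub_sub_cancel_left, poissonKernelLine_neg]
    ring
  calc ∫ x, u x * φ x = ∫ x, ∫ z, φ x * ((poissonKernelLine t (x - z) : ℂ) * g z) := by
        congr 1
        ext x
        rw [hu, poissonIntegral, integral_const_mul, mul_comm]
    _ = ∫ z, ∫ x, φ x * ((poissonKernelLine t (x - z) : ℂ) * g z) := integral_integral_swap h1
    _ = ∫ z, ∫ y, φ (z - y) * g z * (poissonKernelLine t y : ℂ) := by simp only [h3]
    _ = ∫ y, ∫ z, φ (z - y) * g z * (poissonKernelLine t y : ℂ) := (integral_integral_swap h2).symm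
    _ = _ := by
        congr 1
        ext y
        rw [integral_mul_const, poissonKernelLine_neg, distribConv_schwartzReflect, hf]
        simp

theorem exists_isPoissonConv (hg : Integrable g)
    (hf : ∀ φ : 𝓢(ℝ, ℂ), f φ = ∫ x, φ x * g x) {t : ℝ} (ht : 0 < t) :
    ∃ u : ℝ →ᵇ ℂ, IsPoissonConv t f u ∧ ∀ x, u x = poissonIntegral t g x :=
  ⟨BoundedContinuousFunction.ofNormedAddCommGroup _ (continuous_poissonIntegral ht hg) _
    (norm_poissonIntegral_le ht hg),
    isPoissonConv_poissonIntegral hg hf ht fun _ => rfl, fun _ => rfl⟩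

theorem poissonConv_eq_poissonIntegral (hg : Integrable g)
    (hf : ∀ φ : 𝓢(ℝ, ℂ), f φ = ∫ x, φ x * g x) {t : ℝ} (ht : 0 < t) (x : ℝ) :
    poissonConv t f x = poissonIntegral t g x := by
  obtain ⟨u, hu, hux⟩ := exists_isPoissonConv hg hf ht
  rw [(isPoissonConv_poissonConv ⟨u, hu⟩).unique hu, hux]

theorem poissonMaximal_eq (hg : Integrable g)
    (hf : ∀ φ : 𝓢(ℝ, ℂ), f φ = ∫ x, φ x * g x) (x : ℝ) :
    poissonMaximal f x = ⨆ t ∈ Ioi (0 : ℝ), ‖poissonIntegral t g x‖ₑ := by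
  unfold poissonMaximal
  refine iSup_congr fun t => iSup_congr fun ht => ?_
  rw [poissonConv_eq_poissonIntegral hg hf ht]

/-- Dilating the function by u only changes the scale t to tu, which a supremum over all t > 0 does
not notice. -/
theorem poissonIntegral_comp_mul_right {t : ℝ} (ht : 0 < t) {u : ℝ} (hu : 0 < u) (x : ℝ) :
    ∫ y, (poissonKernelLine t (x - y) : ℂ) * g (y * u) = poissonIntegral (t * u) g (x * u) := by
  have h := Measure.integral_comp_mul_right
    (fun y => (poissonKernelLine (t * u) (x * u - y) : ℂ) * g y) u
  rw [abs_of_pos (inv_pos.2 hu)] at h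
  have h2 : ∫ y, (poissonKernelLine t (x - y) : ℂ) * g (y * u) =
      (u : ℂ) * ∫ y, (poissonKernelLine (t * u) (x * u - y * u) : ℂ) * g (y * u) := by
    rw [← integral_const_mul]
    congr 1
    ext y
    rw [← sub_mul, ← poissonKernelLine_mul ht hu]
    push_cast
    ring
  have hu' : (u : ℂ) ≠ 0 := by exact_mod_cast hu.ne'
  rw [h2, h, Complex.real_smul, Complex.ofReal_inv, mul_inv_cancel_left₀ hu', poissonIntegral]

end PoissonIntegral

/-! ### Averages of dilations on H¹ -/

section DilationAverage

variable {κ : ℝ → ℂ} {g : ℝ → ℂ}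

/-- The dilate g(·u) has L¹ norm ‖g‖₁/u, so the double integral is ‖g‖₁ ∫ |κ(u)| du/u. This one fact
yields absolute convergence for almost every x, integrability of the average, and every later use of
Fubini. -/
theorem integrable_mul_comp_mul (hκ : Measurable κ)
    (hκi : IntegrableOn (fun u => ‖κ u‖ / u) (Ioi 1)) (hg : Integrable g) (hgm : Measurable g) :
    Integrable (fun p : ℝ × ℝ => κ p.2 * g (p.1 * p.2))
      (volume.prod (volume.restrict (Ioi 1))) := by
  have hm : Measurable fun p : ℝ × ℝ => κ p.2 * g (p.1 * p.2) := by fun_prop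
  rw [integrable_prod_iff' hm.aestronglyMeasurable]
  constructor
  · filter_upwards [ae_restrict_mem measurableSet_Ioi] with u hu
    have hu0 : u ≠ 0 := (lt_trans one_pos hu).ne'
    exact (hg.comp_mul_right' hu0).const_mul _
  · refine (hκi.mul_const (∫ x, ‖g x‖)).congr ?_
    filter_upwards [ae_restrict_mem measurableSet_Ioi] with u hu
    have hu0 : 0 < u := lt_trans one_pos hu
    simp only [norm_mul]
    rw [integral_const_mul, Measure.integral_comp_mul_right (fun x => ‖g x‖),
      abs_of_pos (inv_pos.2 hu0), smul_eq_mul]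
    ring

theorem poissonIntegral_dilationAverage (hκ : Measurable κ)
    (hκi : IntegrableOn (fun u => ‖κ u‖ / u) (Ioi 1)) (hg : Integrable g) (hgm : Measurable g)
    {t : ℝ} (ht : 0 < t) (x : ℝ) :
    poissonIntegral t (fun y => ∫ u in Ioi (1 : ℝ), κ u * g (y * u)) x =
      ∫ u in Ioi (1 : ℝ), κ u * poissonIntegral (t * u) g (x * u) := by
  have h := (integrable_mul_comp_mul hκ hκi hg hgm).bdd_mul (c := t⁻¹ * Real.pi⁻¹)
    (f := fun p : ℝ × ℝ => (poissonKernelLine t (x - p.1) : ℂ))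
    (Continuous.aestronglyMeasurable (by fun_prop))
    (Filter.Eventually.of_forall fun p => norm_poissonKernelLine_le ht _)
  calc poissonIntegral t (fun y => ∫ u in Ioi (1 : ℝ), κ u * g (y * u)) x
      = ∫ y, ∫ u in Ioi (1 : ℝ), (poissonKernelLine t (x - y) : ℂ) * (κ u * g (y * u)) := by
        simp only [poissonIntegral, integral_const_mul]
    _ = ∫ u in Ioi (1 : ℝ), ∫ y, (poissonKernelLine t (x - y) : ℂ) * (κ u * g (y * u)) :=
        integral_integral_swap h
    _ = _ := by
        refine setIntegral_congr_fun measurableSet_Ioi fun u hu => ?_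
        rw [← poissonIntegral_comp_mul_right ht (lt_trans one_pos hu), ← integral_const_mul]
        congr 1
        ext y
        ring

theorem lintegral_comp_mul_right {M : ℝ → ℝ≥0∞} (hM : Measurable M) {u : ℝ} (hu : 0 < u) :
    ∫⁻ x, M (x * u) = ENNReal.ofReal (1 / u) * ∫⁻ x, M x := by
  rw [← lintegral_map hM (measurable_mul_const u), Real.map_volume_mul_right hu.ne',
    lintegral_smul_measure, abs_of_pos (inv_pos.2 hu), one_div, smul_eq_mul]

/-- An average of dilations `∫ κ(u) g(xu) du` maps `H¹` to itself, with norm at most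
`∫ |κ(u)| du/u`. -/
theorem memH1_dilationAverage (hκ : Measurable κ)
    (hκi : IntegrableOn (fun u => ‖κ u‖ / u) (Ioi 1)) (hg : Integrable g) (hgm : Measurable g)
    {f F : 𝓢'(ℝ, ℂ)} (hf : ∀ φ : 𝓢(ℝ, ℂ), f φ = ∫ x, φ x * g x) (hfH : MemH1 f)
    (hF : ∀ φ : 𝓢(ℝ, ℂ), F φ = ∫ x, φ x * ∫ u in Ioi (1 : ℝ), κ u * g (x * u)) :
    MemH1 F ∧ h1Norm F ≤ (∫ u in Ioi (1 : ℝ), ‖κ u‖ / u) * h1Norm f := by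
  have hG : Integrable fun x => ∫ u in Ioi (1 : ℝ), κ u * g (x * u) :=
    (integrable_mul_comp_mul hκ hκi hg hgm).integral_prod_left
  have hM := measurable_poissonMaximal f
  -- For each t, the term with dilation u uses the scale tu > 0 at the point xu, hence is at most
  -- |κ(u)| M_P f(xu), uniformly in t.
  have hpt : ∀ x, poissonMaximal F x ≤
      ∫⁻ u in Ioi (1 : ℝ), ‖κ u‖ₑ * poissonMaximal f (x * u) := by
    intro x
    rw [poissonMaximal_eq hG hF]
    refine iSup₂_le fun t ht => ?_
    rw [poissonIntegral_dilationAverage hκ hκi hg hgm ht]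
    refine (enorm_integral_le_lintegral_enorm _).trans
      (setLIntegral_mono' measurableSet_Ioi fun u hu => ?_)
    rw [enorm_mul, poissonMaximal_eq hg hf]
    gcongr
    exact le_iSup₂_of_le (f := fun t (_ : t ∈ Ioi (0 : ℝ)) => ‖poissonIntegral t g (x * u)‖ₑ)
      (t * u) (mem_Ioi.2 (mul_pos (mem_Ioi.1 ht) (lt_trans one_pos hu))) le_rfl
  have hκl : ENNReal.ofReal (∫ u in Ioi (1 : ℝ), ‖κ u‖ / u) =
      ∫⁻ u in Ioi (1 : ℝ), ENNReal.ofReal (‖κ u‖ / u) := by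
    refine ofReal_integral_eq_lintegral_ofReal hκi ?_
    filter_upwards [ae_restrict_mem measurableSet_Ioi] with u hu
    exact div_nonneg (norm_nonneg _) (lt_trans one_pos hu).le
  have hle : ∫⁻ x, poissonMaximal F x ≤
      ENNReal.ofReal (∫ u in Ioi (1 : ℝ), ‖κ u‖ / u) * ∫⁻ x, poissonMaximal f x := by
    calc ∫⁻ x, poissonMaximal F x
        ≤ ∫⁻ x, ∫⁻ u in Ioi (1 : ℝ), ‖κ u‖ₑ * poissonMaximal f (x * u) := lintegral_mono hpt
      _ = ∫⁻ u in Ioi (1 : ℝ), ∫⁻ x, ‖κ u‖ₑ * poissonMaximal f (x * u) :=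
          lintegral_lintegral_swap (by fun_prop)
      _ = ∫⁻ u in Ioi (1 : ℝ), ENNReal.ofReal (‖κ u‖ / u) * ∫⁻ x, poissonMaximal f x := by
          refine setLIntegral_congr_fun measurableSet_Ioi fun u hu => ?_
          rw [lintegral_const_mul _ (by fun_prop), lintegral_comp_mul_right hM (lt_trans one_pos hu),
            ← mul_assoc, ← ofReal_norm, ← ENNReal.ofReal_mul (norm_nonneg _), mul_one_div]
      _ = _ := by rw [lintegral_mul_const _ (by fun_prop), hκl]
  have hfin : ENNReal.ofReal (∫ u in Ioi (1 : ℝ), ‖κ u‖ / u) * ∫⁻ x, poissonMaximal f x < ∞ :=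
    ENNReal.mul_lt_top ENNReal.ofReal_lt_top hfH.lintegral_lt_top
  refine ⟨⟨isBoundedDistribution_of_integrable hG hF, fun t ht => ?_, hle.trans_lt hfin⟩, ?_⟩
  · obtain ⟨u, hu, -⟩ := exists_isPoissonConv hG hF ht
    exact ⟨u, hu⟩
  · have h := ENNReal.toReal_mono hfin.ne hle
    rwa [ENNReal.toReal_mul, ENNReal.toReal_ofReal] at h
    refine setIntegral_nonneg measurableSet_Ioi fun u hu => ?_
    exact div_nonneg (norm_nonneg _) (lt_trans one_pos hu).le

end DilationAverage

/-! ### The theorem -/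

theorem mainTheorem2 (n : ℕ) (ε ξ α τ : Fin n → ℝ)
    (hε : ∀ k, 0 < ε k) (hξ : ∀ k, 0 < ξ k) (hα : ∀ k, 0 ≤ α k)
    (h_sum : ∑ k, 1 / ξ k = ∑ k, 1 / ε k)
    (hα_sum : 0 < ∑ k, α k)
    (hτ : ∀ k, -1 < τ k * ξ k)
    (L : KLoop ξ τ) :
    IntegrableOn (fun σ : ℝ => ‖kernelK ε ξ τ α L σ‖ / σ) (Ioi 1) ∧
    ∀ f : 𝓢'(ℝ, ℂ), MemH1 f →
      ∃ g : Lp ℂ 1 (volume : Measure ℝ), Lp.toTemperedDistribution g = f ∧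
        (∀ᵐ x : ℝ, IntegrableOn (fun u : ℝ => kernelK ε ξ τ α L u * g (x * u)) (Ioi 1)) ∧
        ∃ hK : MemLp (operatorK ε ξ τ α L g) 1 volume,
          MemH1 (Lp.toTemperedDistribution hK.toLp) ∧
          h1Norm (Lp.toTemperedDistribution hK.toLp) ≤
            (∫ σ in Ioi (1 : ℝ), ‖kernelK ε ξ τ α L σ‖ / σ) * h1Norm f := by
  have hκ := measurable_kernelK ε ξ τ α L
  have hκi := integrableOn_norm_kernelK_div hε hξ h_sum hα_sum hτ L
  refine ⟨hκi, fun f hf => ?_⟩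
  obtain ⟨g, hgf⟩ := hf.exists_toTemperedDistribution_eq
  have hg : Integrable g := L1.integrable_coeFn g
  -- The chosen representative is itself measurable, not just almost everywhere equal to a
  -- measurable function, so (x, u) ↦ g(xu) is jointly measurable.
  have hgm : Measurable g := (Lp.stronglyMeasurable g).measurable
  have hprod := integrable_mul_comp_mul hκ hκi hg hgm
  have hK : MemLp (operatorK ε ξ τ α L g) 1 volume :=
    memLp_one_iff_integrable.2 hprod.integral_prod_left
  refine ⟨g, hgf, hprod.prod_right_ae, hK,
    memH1_dilationAverage hκ hκi hg hgm (fun φ => ?_) hf fun φ => ?_⟩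
  · rw [← hgf, Lp.toTemperedDistribution_apply]
    rfl
  · rw [Lp.toTemperedDistribution_apply]
    refine integral_congr_ae ?_
    filter_upwards [hK.coeFn_toLp] with x hx
    rw [hx, smul_eq_mul, operatorK]
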